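/- Let $\mathcal A,\mathcal B$ be unital $C^*$-algebras and let $\phi_1,\phi_2:\mathcal A\to\mathcal B$ be unital completely positive maps. Let $\mathcal A*\mathcal A$ be the (unital) full free product of $\mathcal A$ with itself, that is, the completion of the unital algebraic free product $\mathcal A\circ\mathcal A$ in the norm $\|c\|=\sup_\pi\|\pi(c)\|$, $\pi$ ranging over the unital $*$-representations of $\mathcal A\circ\mathcal A$ on Hilbert spaces, and let $\rho_1,\rho_2:\mathcal A\to\mathcal A*\mathcal A$ be the canonical injections. Put $$K(\phi_1,\phi_2)=\{\phi:\mathcal A*\mathcal A\to\mathcal B \text{ completely positive}:\ \phi\circ\rho_1=\phi_1,\ \phi\circ\rho_2=\phi_2\}.$$ A joint representation tuple of $(\phi_1,\phi_2)$ is a tuple $(\mathcal E,\sigma_1,\sigma_2,x)$ consisting of a right Hilbert $\mathcal B$-module $\mathcal E$ (inner product linear in the second variable), two unital $*$-homomorphisms $\sigma_1,\sigma_2:\mathcal A\to\mathcal B^a(\mathcal E)$ into the algebra of bounded adjointable operators on $\mathcal E$, and a vector $x\in\mathcal E$ with $\langle x,x\rangle=1$, such that $\phi_i(a)=\langle x,\sigma_i(a)x\rangle$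 for all $a\in\mathcal A$ and $i=1,2$. It is minimal if the closed linear span of $$\{\sigma_{\epsilon_1}(a_1)\cdots\sigma_{\epsilon_k}(a_k)xb:\ k\ge1,\ \epsilon_j\in\{1,2\},\ a_j\in\mathcal A,\ b\in\mathcal B\}$$ is $\mathcal E$. Two tuples $(\mathcal E,\sigma_1,\sigma_2,x)$ and $(\mathcal E',\sigma_1',\sigma_2',x')$ are isomorphic if there is a right $\mathcal B$-linear, inner-product-preserving bijection $U:\mathcal E\to\mathcal E'$ with $U\sigma_i(a)=\sigma_i'(a)U$ for all $a\in\mathcal A$, $i=1,2$, and $Ux=x'$. Then for every minimal joint representation tuple $(\mathcal E,\sigma_1,\sigma_2,x)$ of $(\phi_1,\phi_2)$ there is a unique unital $*$-homomorphism $\sigma:\mathcal A*\mathcal A\to\mathcal B^a(\mathcal E)$ with $\sigma\circ\rho_1=\sigma_1$ and $\sigma\circ\rho_2=\sigma_2$, and $$\Phi\big([(\mathcal E,\sigma_1,\sigma_2,x)]\big)(c)=\langle x,\sigma(c)x\rangle,\qquad c\in\mathcal A*\mathcal A,$$ defines a bijection $\Phi$ from the set of isomorphism classes of minimal joint representation tuples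 of $(\phi_1,\phi_2)$ onto $K(\phi_1,\phi_2)$. -/

import Mathlib

set_option linter.unusedSectionVars false

open LinearAlgebra
open scoped ComplexConjugate
universe u v
namespace CStarFree

/-- The opposite ring of a complex algebra, with the conjugate complex structure. -/
def ConjOp (W : Type u) : Type u := Wᵐᵒᵖ

noncomputable section

instance (W : Type u) [Ring W] : Ring (ConjOp W) := inferInstanceAs (Ring Wᵐᵒᵖ)

instance (W : Type u) [Ring W] [Algebra ℂ W] : Algebra ℂ (ConjOp W) :=
  ((algebraMap ℂ Wᵐᵒᵖ).comp (starRingEnd ℂ)).toAlgebra' fun c x =>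
    Algebra.commutes (A := Wᵐᵒᵖ) (conj c) x

variable (A : Type u) [CStarAlgebra A]

/-- The unital algebraic free product `A ∘ A` (amalgamated over the unit). -/
def Alg : Type u := FreeProduct ℂ (fun _ : Fin 2 => A)

namespace Alg

instance : Ring (Alg A) := inferInstanceAs (Ring (FreeProduct ℂ (fun _ : Fin 2 => A)))
instance : Algebra ℂ (Alg A) := inferInstanceAs (Algebra ℂ (FreeProduct ℂ (fun _ : Fin 2 => A)))

variable {A}

/-- The canonical maps of `A` into `A ∘ A`. -/
def ι (i : Fin 2) : A →ₐ[ℂ] Alg A := FreeProduct.ι ℂ (fun _ : Fin 2 => A) i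

/-- The homomorphism on `A ∘ A` given by a pair of homomorphisms on `A`. -/
def lift {D : Type v} [Ring D] [Algebra ℂ D] (f : Fin 2 → (A →ₐ[ℂ] D)) : Alg A →ₐ[ℂ] D :=
  FreeProduct.lift ℂ (fun _ : Fin 2 => A) (fun {i} => f i)

theorem lift_ι {D : Type v} [Ring D] [Algebra ℂ D] (f : Fin 2 → (A →ₐ[ℂ] D)) (i : Fin 2) (a : A) :
    lift f (ι i a) = f i a :=
  DFunLike.congr_fun
    (FreeProduct.lift_comp_ι ℂ (fun _ : Fin 2 => A) (fun {i} => f i) (i := i)) a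

theorem hom_ext {D : Type v} [Ring D] [Algebra ℂ D] {f g : Alg A →ₐ[ℂ] D}
    (h : ∀ i a, f (ι i a) = g (ι i a)) : f = g := by
  rw [show f = lift (fun i => g.comp (ι i)) from
      FreeProduct.lift_unique ℂ (fun _ : Fin 2 => A) (fun {i} => g.comp (ι i)) f
        (fun i => AlgHom.ext (h i))]
  exact (FreeProduct.lift_unique ℂ (fun _ : Fin 2 => A) (fun {i} => g.comp (ι i)) g
        (fun i => rfl)).symm

/-- `c ↦ c*`, as a homomorphism into the conjugate opposite algebra. -/
def starHom : Alg A →ₐ[ℂ] ConjOp (Alg A) :=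
  lift (D := ConjOp (Alg A)) fun i =>
    { toFun := fun a => (MulOpposite.op (ι i (star a)) : (Alg A)ᵐᵒᵖ)
      map_one' := by rw [star_one, map_one]; rfl
      map_mul' := fun a b => by rw [star_mul, map_mul]; rfl
      map_zero' := by rw [star_zero, map_zero]; rfl
      map_add' := fun a b => by rw [star_add, map_add]; rfl
      commutes' := fun z => congrArg (MulOpposite.op (α := Alg A))
        ((congrArg (ι i) (algebraMap_star_comm (A := A) z).symm).trans
          ((ι i).commutes (conj z))) }

instance : Star (Alg A) := ⟨fun c => MulOpposite.unop (starHom c)⟩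

theorem star_ι (i : Fin 2) (a : A) : star (ι i a) = ι i (star a) :=
  congrArg MulOpposite.unop (lift_ι (D := ConjOp (Alg A)) _ i a)

theorem star_mul' (c d : Alg A) : star (c * d) = star d * star c :=
  have h : starHom (c * d) = starHom c * starHom d := map_mul (starHom (A := A)) c d
  congrArg MulOpposite.unop h

theorem star_add' (c d : Alg A) : star (c + d) = star c + star d :=
  congrArg MulOpposite.unop (map_add starHom c d)

theorem star_algebraMap' (z : ℂ) :
    star (algebraMap ℂ (Alg A) z) = algebraMap ℂ (Alg A) (conj z) :=
  congrArg MulOpposite.unop (AlgHom.commutes starHom z)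

theorem star_star' (c : Alg A) : star (star c) = c := by
  have h1 : star (1 : Alg A) = 1 := congrArg MulOpposite.unop (map_one starHom)
  have h0 : star (0 : Alg A) = 0 := congrArg MulOpposite.unop (map_zero starHom)
  let f : Alg A →ₐ[ℂ] Alg A :=
    { toFun := fun c => star (star c)
      map_one' := by rw [h1, h1]
      map_mul' := fun a b => by rw [star_mul', star_mul']
      map_zero' := by rw [h0, h0]
      map_add' := fun a b => by rw [star_add', star_add']
      commutes' := fun c => by rw [star_algebraMap', star_algebraMap', Complex.conj_conj] }
  have : f = AlgHom.id ℂ (Alg A) := hom_ext fun i a => by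
    change star (star (ι i a)) = ι i a
    rw [star_ι, star_ι, star_star]
  exact DFunLike.congr_fun this c

instance : StarRing (Alg A) where
  star_involutive := star_star'
  star_mul := star_mul'
  star_add := star_add'

instance : StarModule ℂ (Alg A) where
  star_smul z c := by
    rw [Algebra.smul_def, star_mul, star_algebraMap', Algebra.smul_def, Algebra.commutes]; rfl

theorem induction {p : Alg A → Prop} (hι : ∀ i a, p (ι i a)) (hadd : ∀ c d, p c → p d → p (c + d))
    (hmul : ∀ c d, p c → p d → p (c * d)) (c : Alg A) : p c := by
  let S : Subalgebra ℂ (Alg A) :=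
    { carrier := {c | p c}
      mul_mem' := fun {a b} ha hb => hmul a b ha hb
      add_mem' := fun {a b} ha hb => hadd a b ha hb
      algebraMap_mem' := fun z => by
        have := hι 0 (algebraMap ℂ A z)
        rwa [AlgHom.commutes] at this }
  let f : Alg A →ₐ[ℂ] S := lift fun i => (ι i).codRestrict S (hι i)
  have : S.val.comp f = AlgHom.id ℂ (Alg A) := hom_ext fun i a => by
    change (f (ι i a) : Alg A) = ι i a
    rw [lift_ι]; rfl
  have h := DFunLike.congr_fun this c
  have h2 : (f c : Alg A) = c := h
  exact h2 ▸ (f c).2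

/-- The set of the numbers `‖π c‖`, with `π` ranging over the unital `*`-representations of
`A ∘ A` on Hilbert spaces. -/
def repNorms (c : Alg A) : Set ℝ :=
  {r | ∃ (H : Type u) (_ : NormedAddCommGroup H) (_ : InnerProductSpace ℂ H) (_ : CompleteSpace H)
      (π : Alg A →⋆ₐ[ℂ] (H →L[ℂ] H)), r = ‖π c‖}

theorem repNorms_bddAbove (c : Alg A) : BddAbove (repNorms c) := by
  refine induction (p := fun c => BddAbove (repNorms c)) ?_ ?_ ?_ c
  · rintro i a
    refine ⟨‖a‖, ?_⟩
    rintro _ ⟨H, _, _, _, π, rfl⟩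
    let f : A →⋆ₐ[ℂ] (H →L[ℂ] H) :=
      { (π : Alg A →ₐ[ℂ] (H →L[ℂ] H)).comp (ι i) with
        map_star' := fun a => by
          change π (ι i (star a)) = star (π (ι i a))
          rw [← star_ι, map_star] }
    exact NonUnitalStarAlgHom.norm_apply_le f a
  · rintro c d ⟨x, hx⟩ ⟨y, hy⟩
    refine ⟨x + y, ?_⟩
    rintro _ ⟨H, _, _, _, π, rfl⟩
    rw [map_add]
    exact (norm_add_le _ _).trans
      (add_le_add (hx ⟨H, _, _, ‹_›, π, rfl⟩) (hy ⟨H, _, _, ‹_›, π, rfl⟩))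
  · rintro c d ⟨x, hx⟩ ⟨y, hy⟩
    refine ⟨x * y, ?_⟩
    rintro _ ⟨H, _, _, _, π, rfl⟩
    rw [map_mul]
    have h := hx ⟨H, _, _, ‹_›, π, rfl⟩
    exact (norm_mul_le _ _).trans
      (mul_le_mul h (hy ⟨H, _, _, ‹_›, π, rfl⟩) (norm_nonneg _) ((norm_nonneg _).trans h))

theorem zero_mem_repNorms (c : Alg A) : (0 : ℝ) ∈ repNorms c := by
  let f : Alg A →⋆ₐ[ℂ] (PUnit.{u+1} →L[ℂ] PUnit.{u+1}) :=
    { toFun := fun _ => 0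
      map_one' := Subsingleton.elim _ _
      map_mul' := fun _ _ => Subsingleton.elim _ _
      map_zero' := rfl
      map_add' := fun _ _ => Subsingleton.elim _ _
      commutes' := fun _ => Subsingleton.elim _ _
      map_star' := fun _ => Subsingleton.elim _ _ }
  exact ⟨PUnit, inferInstance, inferInstance, inferInstance, f, norm_zero.symm⟩

/-- The universal `C*`-seminorm `sup ‖π c‖`, over all `*`-representations `π` of `A ∘ A`. -/
def univNorm (c : Alg A) : ℝ := sSup (repNorms c)

theorem norm_rep_le {H : Type u} [NormedAddCommGroup H] [InnerProductSpace ℂ H] [CompleteSpace H]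
    (π : Alg A →⋆ₐ[ℂ] (H →L[ℂ] H)) (c : Alg A) : ‖π c‖ ≤ univNorm c :=
  le_csSup (repNorms_bddAbove c) ⟨H, _, _, ‹_›, π, rfl⟩

theorem univNorm_le {c : Alg A} {K : ℝ}
    (h : ∀ (H : Type u) [NormedAddCommGroup H] [InnerProductSpace ℂ H] [CompleteSpace H]
      (π : Alg A →⋆ₐ[ℂ] (H →L[ℂ] H)), ‖π c‖ ≤ K) : univNorm c ≤ K := by
  refine csSup_le ⟨0, zero_mem_repNorms c⟩ ?_
  rintro _ ⟨H, _, _, _, π, rfl⟩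
  exact h H π

theorem univNorm_nonneg (c : Alg A) : 0 ≤ univNorm c :=
  le_csSup (repNorms_bddAbove c) (zero_mem_repNorms c)

theorem univNorm_neg_le (c : Alg A) : univNorm (-c) ≤ univNorm c :=
  univNorm_le fun H _ _ _ π => by rw [map_neg, norm_neg]; exact norm_rep_le π c

/-- `univNorm` as a seminorm of rings. -/
def univSeminorm : RingSeminorm (Alg A) where
  toFun := univNorm
  map_zero' :=
    le_antisymm (univNorm_le fun H _ _ _ π => by rw [map_zero, norm_zero]) (univNorm_nonneg _)
  add_le' c d := univNorm_le fun H _ _ _ π => by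
    rw [map_add]
    exact (norm_add_le _ _).trans (add_le_add (norm_rep_le π c) (norm_rep_le π d))
  mul_le' c d := univNorm_le fun H _ _ _ π => by
    rw [map_mul]
    exact (norm_mul_le _ _).trans
      (mul_le_mul (norm_rep_le π c) (norm_rep_le π d) (norm_nonneg _) (univNorm_nonneg _))
  neg' c := le_antisymm (univNorm_neg_le c) (by simpa using univNorm_neg_le (-c))

instance : SeminormedRing (Alg A) := (univSeminorm (A := A)).toSeminormedRing

theorem norm_def (c : Alg A) : ‖c‖ = univNorm c := rfl

instance : NormedAlgebra ℂ (Alg A) where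
  norm_smul_le z c := univNorm_le fun H _ _ _ π => by
    rw [map_smul, norm_smul]
    exact mul_le_mul_of_nonneg_left (norm_rep_le π c) (norm_nonneg z)

theorem norm_star_le (c : Alg A) : ‖star c‖ ≤ ‖c‖ :=
  univNorm_le fun H _ _ _ π => by rw [map_star, norm_star]; exact norm_rep_le π c

theorem norm_star' (c : Alg A) : ‖star c‖ = ‖c‖ :=
  le_antisymm (norm_star_le c) (by simpa using norm_star_le (star c))

theorem norm_mul_self_le (c : Alg A) : ‖c‖ * ‖c‖ ≤ ‖star c * c‖ := by
  have h : ‖c‖ ≤ Real.sqrt ‖star c * c‖ := univNorm_le fun H _ _ _ π => by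
    refine Real.le_sqrt_of_sq_le ?_
    rw [sq, ← CStarRing.norm_star_mul_self, ← map_star, ← map_mul]
    exact norm_rep_le π (star c * c)
  calc ‖c‖ * ‖c‖ ≤ Real.sqrt ‖star c * c‖ * Real.sqrt ‖star c * c‖ :=
        mul_self_le_mul_self (univNorm_nonneg c) h
    _ = ‖star c * c‖ := Real.mul_self_sqrt (univNorm_nonneg _)

theorem uniformContinuous_star : UniformContinuous (star : Alg A → Alg A) :=
  (AddMonoidHomClass.isometry_of_norm (starAddEquiv : Alg A ≃+ Alg A) norm_star').uniformContinuous

end Alg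

open UniformSpace

/-- The full free product `A * A`: the completion of `A ∘ A` in the universal norm. -/
def Full (A : Type u) [CStarAlgebra A] : Type u := Completion (Alg A)

namespace Full

variable {A}

instance : NormedRing (Full A) := inferInstanceAs (NormedRing (Completion (Alg A)))
instance : CompleteSpace (Full A) := inferInstanceAs (CompleteSpace (Completion (Alg A)))
instance : Algebra ℂ (Full A) := inferInstanceAs (Algebra ℂ (Completion (Alg A)))

/-- The canonical map `A ∘ A → A * A`. -/
def of : Alg A →ₐ[ℂ] Full A :=
  { (Completion.coeRingHom : Alg A →+* Completion (Alg A)) with commutes' := fun _ => rfl }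

theorem norm_of (c : Alg A) : ‖of c‖ = ‖c‖ := Completion.norm_coe c

theorem induction {p : Full A → Prop} (hp : IsClosed {c | p c}) (h : ∀ c : Alg A, p (of c))
    (c : Full A) : p c :=
  Completion.induction_on c hp h

theorem continuous_of : Continuous (of : Alg A → Full A) := Completion.continuous_coe (Alg A)

instance : NormedAlgebra ℂ (Full A) where
  norm_smul_le z c := by
    refine induction (p := fun c => ‖z • c‖ ≤ ‖z‖ * ‖c‖) ?_ (fun c => ?_) c
    · simp only [Algebra.smul_def]
      exact isClosed_le (by fun_prop) (by fun_prop)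
    · rw [← map_smul, norm_of, norm_of]
      exact norm_smul_le z c

instance : Star (Full A) := ⟨Completion.map star⟩

theorem continuous_star' : Continuous (star : Full A → Full A) := Completion.continuous_map

theorem star_of (c : Alg A) : star (of c) = of (star c) :=
  Completion.map_coe Alg.uniformContinuous_star c

instance : StarRing (Full A) where
  star_involutive c := by
    refine induction (p := fun c => star (star c) = c)
      (isClosed_eq (continuous_star'.comp continuous_star') continuous_id) (fun c => ?_) c
    rw [star_of, star_of, star_star]
  star_mul c d := by
    refine Completion.induction_on₂ (p := fun c d : Full A => star (c * d) = star d * star c) c d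
      ?_ (fun c d => ?_)
    · exact isClosed_eq (continuous_star'.comp (continuous_fst.mul continuous_snd))
        ((continuous_star'.comp continuous_snd).mul (continuous_star'.comp continuous_fst))
    · change star (of c * of d) = star (of d) * star (of c)
      rw [← map_mul, star_of, star_of, star_of, star_mul, map_mul]
  star_add c d := by
    refine Completion.induction_on₂ (p := fun c d : Full A => star (c + d) = star c + star d) c d
      ?_ (fun c d => ?_)
    · exact isClosed_eq (continuous_star'.comp (continuous_fst.add continuous_snd))
        ((continuous_star'.comp continuous_fst).add (continuous_star'.comp continuous_snd))
    · change star (of c + of d) = star (of c) + star (of d)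
      rw [← map_add, star_of, star_of, star_of, star_add, map_add]

instance : CStarAlgebra (Full A) where
  norm_mul_self_le c := by
    refine induction (p := fun c => ‖c‖ * ‖c‖ ≤ ‖star c * c‖)
      (isClosed_le (by fun_prop) ((continuous_star'.mul continuous_id).norm)) (fun c => ?_) c
    rw [star_of, ← map_mul, norm_of, norm_of]
    exact Alg.norm_mul_self_le c
  star_smul z c := by
    refine induction (p := fun c => star (z • c) = star z • star c)
      (isClosed_eq (continuous_star'.comp (continuous_const_smul z))
        (continuous_star'.const_smul (star z))) (fun c => ?_) c
    rw [← map_smul, star_of, star_of, star_smul, map_smul]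

instance : PartialOrder (Full A) := CStarAlgebra.spectralOrder (Full A)
instance : StarOrderedRing (Full A) := CStarAlgebra.spectralOrderedRing (Full A)

/-- The canonical injections `ρ₁ = ρ 0` and `ρ₂ = ρ 1` of `A` into `A * A`. -/
def ρ (i : Fin 2) : A →⋆ₐ[ℂ] Full A :=
  { of.comp (Alg.ι i) with
    map_star' := fun a => by
      change of (Alg.ι i (star a)) = star (of (Alg.ι i a))
      rw [star_of, Alg.star_ι] }

end Full

end

end CStarFree

/-! ## Hilbert modules

`Mathlib` writes a module action on the left, with `⟪x, a • y⟫ = a * ⟪x, y⟫`.  A *right* Hilbert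
`B`-module is therefore a `CStarModule` over the opposite algebra `Bᵐᵒᵖ`, where `op b • y` is
`y b`; its `B`-valued inner product `innerB` satisfies `⟪x, y b⟫ = ⟪x, y⟫ b`. -/

namespace HilbertModule

open MulOpposite CStarModule

noncomputable section

variable {B : Type v} [CStarAlgebra B] [PartialOrder B] [StarOrderedRing B]
  {E : Type*} [NormedAddCommGroup E] [NormedSpace ℂ E] [Module Bᵐᵒᵖ E] [CStarModule Bᵐᵒᵖ E]

variable (B) in
/-- The `B`-valued inner product of a right Hilbert `B`-module, linear in the second variable. -/
def innerB (x y : E) : B := unop (inner Bᵐᵒᵖ x y)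

theorem innerB_smul_right (x y : E) (b : B) : innerB B x (op b • y) = innerB B x y * b := by
  simp [innerB]

theorem star_innerB (x y : E) : star (innerB B x y) = innerB B y x := by
  simp only [innerB, ← unop_star, star_inner]

theorem innerB_self_nonneg (x : E) : 0 ≤ innerB B x x :=
  inner_self_nonneg (A := Bᵐᵒᵖ) (x := x)

theorem innerB_add_right (x y z : E) : innerB B x (y + z) = innerB B x y + innerB B x z := by
  simp [innerB]

theorem innerB_add_left (x y z : E) : innerB B (x + y) z = innerB B x z + innerB B y z := by
  simp [innerB]

theorem innerB_complex_smul_right (z : ℂ) (x y : E) : innerB B x (z • y) = z • innerB B x y := by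
  simp [innerB]

theorem innerB_complex_smul_left (z : ℂ) (x y : E) :
    innerB B (z • x) y = star z • innerB B x y := by
  simp [innerB]

theorem innerB_ext {x y : E} (h : ∀ z, innerB B z x = innerB B z y) : x = y := by
  have h1 : inner Bᵐᵒᵖ (x - y) (x - y) = 0 := by
    rw [CStarModule.inner_sub_right, sub_eq_zero]
    exact unop_injective (h (x - y))
  exact sub_eq_zero.mp ((inner_self (A := Bᵐᵒᵖ)).mp h1)

variable (B E) in
/-- The algebra `𝓑ᵃ(E)` of the bounded operators on `E` that have an adjoint with respect to the
`B`-valued inner product. -/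
def adjointable : Subalgebra ℂ (E →L[ℂ] E) where
  carrier := {T | ∃ S : E →L[ℂ] E, ∀ x y, innerB B (T x) y = innerB B x (S y)}
  mul_mem' := by
    rintro T T' ⟨S, hS⟩ ⟨S', hS'⟩
    exact ⟨S' * S, fun x y => by
      simp only [mul_apply_eq_comp, hS, hS']⟩
  add_mem' := by
    rintro T T' ⟨S, hS⟩ ⟨S', hS'⟩
    exact ⟨S + S', fun x y => by
      simp only [add_apply, innerB_add_left, innerB_add_right, hS, hS']⟩
  algebraMap_mem' z := ⟨star z • 1, fun x y => by
    simp [Algebra.algebraMap_eq_smul_one, innerB_complex_smul_left, innerB_complex_smul_right]⟩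

/-- The involution of `𝓑ᵃ(E)`: the adjoint. -/
instance : Star (adjointable B E) :=
  ⟨fun T => ⟨T.2.choose, T.1, fun x y => by
    rw [← star_innerB, ← T.2.choose_spec, star_innerB]⟩⟩

theorem innerB_apply_left (T : adjointable B E) (x y : E) :
    innerB B (T.1 x) y = innerB B x ((star T).1 y) :=
  T.2.choose_spec x y

theorem adjoint_unique {T S : adjointable B E}
    (h : ∀ x y, innerB B (T.1 x) y = innerB B x (S.1 y)) : star T = S :=
  Subtype.ext <| ContinuousLinearMap.ext fun y => innerB_ext (B := B) fun x => by
    rw [← innerB_apply_left, h]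

instance : StarRing (adjointable B E) where
  star_involutive T := adjoint_unique fun x y => by
    rw [← star_innerB, ← innerB_apply_left, star_innerB]
  star_mul T S := adjoint_unique fun x y => by
    change innerB B (T.1 (S.1 x)) y = innerB B x ((star S).1 ((star T).1 y))
    rw [innerB_apply_left, innerB_apply_left]
  star_add T S := adjoint_unique fun x y => by
    change innerB B (T.1 x + S.1 x) y = innerB B x ((star T).1 y + (star S).1 y)
    rw [innerB_add_left, innerB_add_right, innerB_apply_left, innerB_apply_left]

instance : StarModule ℂ (adjointable B E) where
  star_smul z T := adjoint_unique fun x y => by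
    change innerB B (z • T.1 x) y = innerB B x (star z • (star T).1 y)
    rw [innerB_complex_smul_left, innerB_complex_smul_right, innerB_apply_left]

end

end HilbertModule

namespace JointRepresentation

open HilbertModule CStarFree MulOpposite
open scoped CStarAlgebra

variable {A : Type u} {B : Type v} [CStarAlgebra A] [PartialOrder A] [StarOrderedRing A]
  [CStarAlgebra B] [PartialOrder B] [StarOrderedRing B]

/-- A joint representation tuple `(E, σ₁, σ₂, x)` of `(φ₁, φ₂)`: a right Hilbert `B`-module `E`
with two unital left actions `σ₁, σ₂ : A → 𝓑ᵃ(E)` and a unit vector `x` with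
`φᵢ a = ⟪x, σᵢ a x⟫`. -/
structure Tuple (φ₁ φ₂ : A →CP B) : Type (max u v + 1) where
  E : Type (max u v)
  [normedAddCommGroup : NormedAddCommGroup E]
  [normedSpace : NormedSpace ℂ E]
  [completeSpace : CompleteSpace E]
  [module : Module Bᵐᵒᵖ E]
  [cstarModule : CStarModule Bᵐᵒᵖ E]
  σ₁ : A →⋆ₐ[ℂ] adjointable B E
  σ₂ : A →⋆ₐ[ℂ] adjointable B E
  x : E
  inner_x : innerB B x x = 1
  repr₁ : ∀ a, φ₁ a = innerB B x ((σ₁ a).1 x)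
  repr₂ : ∀ a, φ₂ a = innerB B x ((σ₂ a).1 x)

namespace Tuple

attribute [instance] normedAddCommGroup normedSpace completeSpace module cstarModule

variable {φ₁ φ₂ : A →CP B}

/-- The operator `σ_{ε₁}(a₁) ⋯ σ_{εₖ}(aₖ)`; a letter `inl a` stands for `σ₁ a`, and `inr a` for
`σ₂ a`. -/
noncomputable def word (T : Tuple φ₁ φ₂) (l : List (A ⊕ A)) : adjointable B T.E :=
  (l.map (Sum.elim T.σ₁ T.σ₂)).prod

/-- The closed span of the vectors `σ_{ε₁}(a₁) ⋯ σ_{εₖ}(aₖ) x b`, `k ≥ 1`, is all of `E`. -/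
def IsMinimal (T : Tuple φ₁ φ₂) : Prop :=
  (Submodule.span ℂ {y : T.E | ∃ l : List (A ⊕ A), l ≠ [] ∧ ∃ b : B,
    y = (T.word l).1 (op b • T.x)}).topologicalClosure = ⊤

/-- Isomorphism of tuples: a right `B`-linear unitary that intertwines the left actions and maps
one distinguished vector to the other. -/
def Iso (T S : Tuple φ₁ φ₂) : Prop :=
  ∃ U : T.E ≃ₗ[ℂ] S.E,
    (∀ y z, innerB B (U y) (U z) = innerB B y z) ∧
    (∀ (b : B) y, U (op b • y) = op b • U y) ∧
    (∀ a y, U ((T.σ₁ a).1 y) = (S.σ₁ a).1 (U y)) ∧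
    (∀ a y, U ((T.σ₂ a).1 y) = (S.σ₂ a).1 (U y)) ∧
    U T.x = S.x

theorem Iso.refl (T : Tuple φ₁ φ₂) : Iso T T :=
  ⟨LinearEquiv.refl ℂ T.E, fun _ _ => rfl, fun _ _ => rfl, fun _ _ => rfl, fun _ _ => rfl, rfl⟩

theorem Iso.symm {T S : Tuple φ₁ φ₂} : Iso T S → Iso S T := by
  rintro ⟨U, h1, h2, h3, h4, h5⟩
  refine ⟨U.symm, fun y z => ?_, fun b y => ?_, fun a y => ?_, fun a y => ?_, ?_⟩
  · rw [← h1, U.apply_symm_apply, U.apply_symm_apply]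
  · rw [U.symm_apply_eq, h2, U.apply_symm_apply]
  · rw [U.symm_apply_eq, h3, U.apply_symm_apply]
  · rw [U.symm_apply_eq, h4, U.apply_symm_apply]
  · rw [U.symm_apply_eq, h5]

theorem Iso.trans {T S R : Tuple φ₁ φ₂} : Iso T S → Iso S R → Iso T R := by
  rintro ⟨U, h1, h2, h3, h4, h5⟩ ⟨V, k1, k2, k3, k4, k5⟩
  refine ⟨U.trans V, fun y z => ?_, fun b y => ?_, fun a y => ?_, fun a y => ?_, ?_⟩
  · simp only [LinearEquiv.trans_apply, k1, h1]
  · simp only [LinearEquiv.trans_apply, h2, k2]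
  · simp only [LinearEquiv.trans_apply, h3, k3]
  · simp only [LinearEquiv.trans_apply, h4, k4]
  · simp only [LinearEquiv.trans_apply, h5, k5]

/-- `σ` is a left action of `A * A` on `E` with `σ ∘ ρ₁ = σ₁` and `σ ∘ ρ₂ = σ₂`. -/
def Extends (T : Tuple φ₁ φ₂) (σ : Full A →⋆ₐ[ℂ] adjointable B T.E) : Prop :=
  (∀ a, σ (Full.ρ 0 a) = T.σ₁ a) ∧ ∀ a, σ (Full.ρ 1 a) = T.σ₂ a

end Tuple

/-- Minimal joint representation tuples. -/
def MinimalTuple (φ₁ φ₂ : A →CP B) : Type (max u v + 1) := {T : Tuple φ₁ φ₂ // T.IsMinimal}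

/-- Isomorphism of minimal joint representation tuples. -/
instance minimalSetoid (φ₁ φ₂ : A →CP B) : Setoid (MinimalTuple φ₁ φ₂) where
  r T S := T.1.Iso S.1
  iseqv := ⟨fun T => .refl T.1, .symm, .trans⟩

/-- The completely positive maps `φ` on `A * A` with `φ ∘ ρ₁ = φ₁` and `φ ∘ ρ₂ = φ₂`. -/
def K (φ₁ φ₂ : A →CP B) : Type (max u v) :=
  {φ : Full A →CP B // (∀ a, φ (Full.ρ 0 a) = φ₁ a) ∧ ∀ a, φ (Full.ρ 1 a) = φ₂ a}

end JointRepresentation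

/-! ### Positivity: matrices, completely positive maps, positive functionals -/

section Positivity

open scoped CStarAlgebra ComplexOrder

/-! A minimal tuple is a cyclic representation of `A * A` on a Hilbert `B`-module in disguise, and
the bijection is the GNS correspondence for completely positive maps (Paschke's construction, here
`KSGNS`), applied to the free product.

From tuples to representations: `σ₁` and `σ₂` define a representation of `A ∘ A` by the universal
property, which must be shown contractive in order to extend to the completion. The universal norm
only sees Hilbert spaces, so the module is scalarized. A positive functional `f` on `B` that norms
`⟪π c y, π c y⟫` (`CStarAlgebra.exists_positive_functional`) turns `c ↦ f ⟪y, π c y⟫` into a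
positive functional `ω` on `A ∘ A`. Its GNS representation on a Hilbert space gives `ω (c* c) ≤ ‖c‖²
ω 1` (`le_norm_sq`), which is the bound required (`norm_algRep_apply_le`). The extension is unique
because representations of a C*-algebra are strongly continuous (`fullRep_ext`). Nonempty words span
`A ∘ A`, so minimality says exactly that `x` is cyclic for the extension (`isMinimal_iff`).

Injectivity: `⟪σ(a) x b, σ(c) x d⟫ = b* φ(a* c) d`, where `φ` is the map of the tuple. Two cyclic
representations with the same `φ` thus have orbit vectors with the same inner products, and matching
these vectors extends to a unitary (`exists_unitary`, `iso_of_toK_eq`).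

Surjectivity: given `φ`, that formula defines a form on the finitely supported functions `C →₀ B`,
where `C = A * A`. It is positive semidefinite by complete positivity; separation and completion
give a module with a cyclic vector whose map is `φ`. Restricting the action along `ρ₁` and `ρ₂`
gives the tuple (`K.toTuple`). -/

theorem CStarAlgebra.exists_eq_star_mul_self {D : Type*} [CStarAlgebra D] [PartialOrder D]
    [StarOrderedRing D] {x : D} (hx : 0 ≤ x) : ∃ y, x = star y * y :=
  CStarAlgebra.nonneg_iff_eq_star_mul_self.mp hx

/-- Compressing a selfadjoint element to its negative part yields minus a square, which vanishes
only for positive elements. -/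
theorem IsSelfAdjoint.exists_conjugate_eq_neg {D : Type*} [CStarAlgebra D] [PartialOrder D]
    [StarOrderedRing D] {x : D} (hx : IsSelfAdjoint x) :
    ∃ n m : D, star n * x * n = -(star m * m) ∧ (m = 0 → 0 ≤ x) := by
  have hn : 0 ≤ x⁻ := CFC.negPart_nonneg x
  have h3 : 0 ≤ star x⁻ * x⁻ * x⁻ := by
    rw [(IsSelfAdjoint.of_nonneg hn).star_eq]
    have := (IsSelfAdjoint.of_nonneg hn).conjugate_nonneg hn
    exact this
  obtain ⟨m, hm⟩ := CStarAlgebra.nonneg_iff_eq_star_mul_self.mp h3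
  refine ⟨x⁻, m, ?_, fun h0 => ?_⟩
  · rw [← hm]
    have h1 : x * x⁻ = -(x⁻ * x⁻) := by
      nth_rewrite 1 [← CFC.posPart_sub_negPart x hx]
      rw [sub_mul, CFC.posPart_mul_negPart, zero_sub]
    rw [mul_assoc, h1, mul_neg, mul_assoc]
  · rw [h0, mul_zero] at hm
    have h2 : x⁻ * x⁻ = 0 := by
      have : star (x⁻ * x⁻) * (x⁻ * x⁻) = 0 := by
        rw [star_mul, mul_assoc, ← mul_assoc (star x⁻) (x⁻) (x⁻), hm, mul_zero]
      exact (CStarRing.star_mul_self_eq_zero_iff _).mp this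
    have h1 : x⁻ = 0 := by
      refine (CStarRing.star_mul_self_eq_zero_iff _).mp ?_
      rw [(IsSelfAdjoint.of_nonneg hn).star_eq, h2]
    exact (CFC.negPart_eq_zero_iff x hx).mp h1

variable {B : Type*} [CStarAlgebra B] [PartialOrder B] [StarOrderedRing B]

theorem CStarMatrix.eq_zero_of_sum_star_mul_self {n : Type*} [Fintype n] {m : CStarMatrix n n B}
    (h : ∀ j, ∑ k, star (m k j) * m k j ≤ 0) : m = 0 := by
  ext k j
  have h1 : ∑ k, star (m k j) * m k j = 0 :=
    le_antisymm (h j) (Finset.sum_nonneg fun k _ => star_mul_self_nonneg _)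
  rw [Finset.sum_eq_zero_iff_of_nonneg fun k _ => star_mul_self_nonneg _] at h1
  exact (CStarRing.star_mul_self_eq_zero_iff _).mp (h1 k (Finset.mem_univ k))

/-- A selfadjoint matrix over a `C*`-algebra is positive if its quadratic form is. -/
theorem CStarMatrix.nonneg_of_forall_sum {n : Type*} [Fintype n] [DecidableEq n]
    {G : CStarMatrix n n B} (hG : IsSelfAdjoint G)
    (h : ∀ b : n → B, 0 ≤ ∑ i, ∑ j, star (b i) * G i j * b j) : 0 ≤ G := by
  obtain ⟨N, m, hm, h0⟩ := hG.exists_conjugate_eq_neg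
  -- The columns of `N` are used as test vectors: the `j`-th diagonal entry of `N* G N` is the
  -- quadratic form at column `j`, but it is also minus a sum of squares.
  refine h0 (CStarMatrix.eq_zero_of_sum_star_mul_self fun j => ?_)
  have h1 := h fun i => N i j
  have h2 : ∑ i, ∑ l, star (N i j) * G i l * N l j = -∑ k, star (m k j) * m k j := by
    have h3 := congrFun (congrFun hm j) j
    have h4 : (-(star m * m)) j j = -((star m * m) j j) := rfl
    rw [h4, CStarMatrix.mul_apply, CStarMatrix.mul_apply] at h3
    simp only [CStarMatrix.mul_apply, CStarMatrix.star_apply, Finset.sum_mul] at h3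
    rw [Finset.sum_comm]
    exact h3
  rw [h2] at h1
  exact neg_nonneg.mp h1

theorem CStarMatrix.sum_nonneg {n : Type*} [Fintype n]
    {G : CStarMatrix n n B} (hG : 0 ≤ G) (b : n → B) :
    0 ≤ ∑ i, ∑ j, star (b i) * G i j * b j := by
  classical
  obtain ⟨Z, rfl⟩ := CStarAlgebra.exists_eq_star_mul_self hG
  have : ∑ i, ∑ j, star (b i) * (star Z * Z) i j * b j
      = ∑ k, star (∑ i, Z k i * b i) * ∑ j, Z k j * b j := by
    simp only [CStarMatrix.mul_apply, CStarMatrix.star_apply, star_sum, star_mul,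
      Finset.mul_sum, Finset.sum_mul]
    rw [Finset.sum_congr rfl fun i _ => Finset.sum_comm, Finset.sum_comm]
    refine Finset.sum_congr rfl fun k _ => ?_
    rw [Finset.sum_comm]
    simp only [mul_assoc]
  rw [this]
  exact Finset.sum_nonneg fun k _ => star_mul_self_nonneg _

variable {C : Type*} [CStarAlgebra C] [PartialOrder C] [StarOrderedRing C]

/-- The matrix `(aᵢ* aⱼ)` is positive, so its entrywise image under `φ` is positive. -/
theorem CompletelyPositiveMap.sum_nonneg (φ : C →CP B) {n : Type*} [Fintype n] (a : n → C)
    (b : n → B) : 0 ≤ ∑ i, ∑ j, star (b i) * φ (star (a i) * a j) * b j := by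
  classical
  rcases isEmpty_or_nonempty n with hn | ⟨⟨i₀⟩⟩
  · simp
  -- A square root has to be a square matrix, so the row `a` is padded with zero rows; this needs an
  -- index `i₀`.
  let N : CStarMatrix n n C := CStarMatrix.ofMatrix fun i j => if i = i₀ then a j else 0
  have hNa : ∀ i j, N i j = if i = i₀ then a j else 0 := fun _ _ => rfl
  have hN : ∀ i j, (star N * N) i j = star (a i) * a j := fun i j => by
    rw [CStarMatrix.mul_apply, Finset.sum_eq_single i₀]
    · simp [hNa, CStarMatrix.star_apply]
    · intro k _ hk
      simp [hNa, CStarMatrix.star_apply, hk]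
    · simp
  have := CStarMatrix.sum_nonneg (φ.map_cstarMatrix_nonneg (star N * N) (star_mul_self_nonneg N)) b
  simpa only [CStarMatrix.map_apply, hN] using this

/-- A star-preserving linear map with positive associated sesquilinear forms is completely
positive. -/
def CompletelyPositiveMap.ofSumNonneg (f : C →ₗ[ℂ] B) (hs : ∀ c, f (star c) = star (f c))
    (h : ∀ (k : ℕ) (a : Fin k → C) (b : Fin k → B),
      0 ≤ ∑ i, ∑ j, star (b i) * f (star (a i) * a j) * b j) : C →CP B where
  toLinearMap := f
  map_cstarMatrix_nonneg' k M hM := by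
    obtain ⟨N, rfl⟩ := CStarAlgebra.exists_eq_star_mul_self hM
    refine CStarMatrix.nonneg_of_forall_sum ?_ fun b => ?_
    · ext i j
      rw [CStarMatrix.star_apply, CStarMatrix.map_apply, CStarMatrix.map_apply, ← hs,
        ← CStarMatrix.star_apply, star_mul, star_star]
    -- Each row of `N` contributes one form of the kind covered by `h`.
    · have : ∑ i, ∑ j, star (b i) * ((star N * N).map f) i j * b j
          = ∑ l, ∑ i, ∑ j, star (b i) * f (star (N l i) * N l j) * b j := by
        simp only [CStarMatrix.map_apply, CStarMatrix.mul_apply, CStarMatrix.star_apply, map_sum,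
          Finset.mul_sum, Finset.sum_mul]
        rw [Finset.sum_congr rfl fun i _ => Finset.sum_comm, Finset.sum_comm]
      rw [this]
      exact Finset.sum_nonneg fun l _ => h k (fun i => N l i) b

/-- This equality forces a norming functional of `h + 1` to attain the norm at both `h` and `1`. A
contractive functional with real part `1` at the unit has nonnegative real part on positive
elements. -/
theorem CStarAlgebra.norm_add_one_of_nonneg [Nontrivial B] {h : B} (hh : 0 ≤ h) :
    ‖h + 1‖ = ‖h‖ + 1 := by
  refine le_antisymm ((norm_add_le _ _).trans (by rw [norm_one])) ?_
  have h1 : (1 : B) ≤ h + 1 := le_add_of_nonneg_left hh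
  have h2 : 1 ≤ ‖h + 1‖ := by
    simpa using CStarAlgebra.norm_le_norm_of_nonneg_of_le zero_le_one h1
  have h3 : h + 1 ≤ algebraMap ℝ B ‖h + 1‖ :=
    IsSelfAdjoint.le_algebraMap_norm_self (.of_nonneg (zero_le_one.trans h1))
  have h4 : ‖h‖ ≤ ‖h + 1‖ - 1 := by
    rw [CStarAlgebra.norm_le_iff_le_algebraMap h (sub_nonneg.mpr h2) hh, map_sub, map_one]
    exact le_sub_iff_add_le.mpr h3
  linarith

theorem CStarAlgebra.norm_norm_sub_le {h : B} (hh : 0 ≤ h) :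
    ‖algebraMap ℝ B ‖h‖ - h‖ ≤ ‖h‖ := by
  have h1 : 0 ≤ algebraMap ℝ B ‖h‖ - h :=
    sub_nonneg.mpr (IsSelfAdjoint.le_algebraMap_norm_self (.of_nonneg hh))
  rw [CStarAlgebra.norm_le_iff_le_algebraMap _ (norm_nonneg h) h1]
  exact sub_le_self _ hh

/-- Every positive element of a `C*`-algebra is normed by a positive functional. -/
theorem CStarAlgebra.exists_positive_functional {h : B} (hh : 0 ≤ h) :
    ∃ f : B →ₗ[ℂ] ℂ, (∀ x, 0 ≤ x → 0 ≤ f x) ∧ (∀ x, f (star x) = conj (f x)) ∧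
      f h = ‖h‖ ∧ ∀ x, ‖f x‖ ≤ ‖x‖ := by
  rcases subsingleton_or_nontrivial B with hB | hB
  · exact ⟨0, fun _ _ => le_rfl, by simp, by simp [Subsingleton.elim h 0], by simp⟩
  obtain ⟨g, hg1, hg⟩ := exists_dual_vector'' ℂ (h + 1)
  have hgle : ∀ x, ‖g x‖ ≤ ‖x‖ := fun x =>
    (g.le_opNorm x).trans (mul_le_of_le_one_left (norm_nonneg _) hg1)
  have hre : ∀ x, (g x).re ≤ ‖x‖ := fun x => (Complex.re_le_norm _).trans (hgle x)
  -- The summands are at most `‖h‖` and `1`, so equality of the sums forces equality in each.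
  have hsum : (g h).re + (g 1).re = ‖h‖ + 1 := by
    rw [← Complex.add_re, ← map_add, hg, CStarAlgebra.norm_add_one_of_nonneg hh]
    simp
  have hg1' : (g 1).re ≤ 1 := by simpa using hre 1
  have hh' := hre h
  have hone : (g 1).re = 1 := by linarith
  have hnh : (g h).re = ‖h‖ := by linarith
  -- Since `‖‖x‖ - x‖ ≤ ‖x‖` and `Re g 1 = 1`, it follows that `‖x‖ - Re g x ≤ ‖x‖`.
  have hpos : ∀ x : B, 0 ≤ x → 0 ≤ (g x).re := fun x hx => by
    have h1 := (hre _).trans (CStarAlgebra.norm_norm_sub_le hx)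
    have h2 : algebraMap ℝ B ‖x‖ = (‖x‖ : ℂ) • (1 : B) := by
      rw [Algebra.algebraMap_eq_smul_one]; exact (Complex.coe_smul _ _).symm
    rw [h2, map_sub, map_smul, Complex.sub_re, smul_eq_mul, Complex.re_ofReal_mul, hone] at h1
    linarith
  -- Averaging `g` with its adjoint makes it hermitian and equal to `Re g` on selfadjoint elements.
  let f : B →ₗ[ℂ] ℂ :=
    { toFun := fun x => (g x + conj (g (star x))) / 2
      map_add' := fun x y => by simp only [star_add, map_add]; ring
      map_smul' := fun z x => by simp; ring }
  have hf : ∀ x, f x = (g x + conj (g (star x))) / 2 := fun _ => rfl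
  have hfs : ∀ x, IsSelfAdjoint x → f x = ((g x).re : ℂ) := fun x hx => by
    rw [hf, hx.star_eq, Complex.add_conj]
    push_cast; ring
  refine ⟨f, fun x hx => ?_, fun x => ?_, ?_, fun x => ?_⟩
  · rw [hfs x (.of_nonneg hx)]
    exact_mod_cast hpos x hx
  · rw [hf, hf, star_star, map_div₀, map_add, Complex.conj_conj, add_comm, map_ofNat]
  · rw [hfs h (.of_nonneg hh), hnh]
  · rw [hf, norm_div, Complex.norm_ofNat, div_le_iff₀ two_pos]
    refine (norm_add_le _ _).trans ?_
    have h1 := hgle (star x)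
    rw [norm_star] at h1
    rw [Complex.norm_conj]
    linarith [hgle x]

end Positivity

/-! ### The GNS representation of a positive functional on `A ∘ A` -/

namespace CStarFree.Alg

open scoped ComplexOrder InnerProductSpace
open UniformSpace

noncomputable section

variable {A : Type u} [CStarAlgebra A]

variable (A) in
/-- Positive linear functionals on the algebraic free product. -/
structure PositiveFunctional where
  toLinearMap : Alg A →ₗ[ℂ] ℂ
  map_star : ∀ c, toLinearMap (star c) = conj (toLinearMap c)
  nonneg : ∀ c, 0 ≤ toLinearMap (star c * c)

namespace PositiveFunctional

variable (ω : PositiveFunctional A)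

instance : CoeFun (PositiveFunctional A) (fun _ => Alg A → ℂ) := ⟨fun ω => ω.toLinearMap⟩

/-- The space `A ∘ A` with the semi-inner product `⟪c, d⟫ = ω (c* d)`. -/
def PreGNS (_ : PositiveFunctional A) : Type u := Alg A

instance : AddCommGroup ω.PreGNS := inferInstanceAs (AddCommGroup (Alg A))
instance : Module ℂ ω.PreGNS := inferInstanceAs (Module ℂ (Alg A))

/-- The identification of `A ∘ A` with its GNS space. -/
def toPre : Alg A ≃ₗ[ℂ] ω.PreGNS := LinearEquiv.refl ℂ _

/-- The inverse of `toPre`. -/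
def ofPre : ω.PreGNS ≃ₗ[ℂ] Alg A := ω.toPre.symm

@[simp] theorem toPre_ofPre (c : ω.PreGNS) : ω.toPre (ω.ofPre c) = c := rfl
@[simp] theorem ofPre_toPre (c : Alg A) : ω.ofPre (ω.toPre c) = c := rfl

/-- The semi-inner product of the GNS construction. -/
abbrev core : PreInnerProductSpace.Core ℂ ω.PreGNS where
  inner c d := ω (star (ω.ofPre c) * ω.ofPre d)
  conj_inner_symm c d := by rw [← ω.map_star, star_mul, star_star]
  re_inner_nonneg c := (RCLike.nonneg_iff.mp (ω.nonneg _)).1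
  add_left c d e := by rw [map_add, star_add, add_mul, map_add]
  smul_left c d z := by rw [map_smul, star_smul, smul_mul_assoc, map_smul]; rfl

instance : SeminormedAddCommGroup ω.PreGNS :=
  InnerProductSpace.Core.toSeminormedAddCommGroup (c := ω.core)
instance : InnerProductSpace ℂ ω.PreGNS := InnerProductSpace.ofCore ω.core

theorem inner_def (c d : ω.PreGNS) : ⟪c, d⟫_ℂ = ω (star (ω.ofPre c) * ω.ofPre d) := rfl

theorem norm_sq (c : ω.PreGNS) : ‖c‖ ^ 2 = (ω (star (ω.ofPre c) * ω.ofPre c)).re :=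
  (inner_self_eq_norm_sq (𝕜 := ℂ) c).symm

/-- Bounded left multiplications are closed under sums and products, so generators suffice. For
these, `‖a‖² - a* a = b* b` already in `A`, and the term `ω ((b d)* (b d))` can be dropped. -/
theorem exists_bound (c : Alg A) :
    ∃ K, ∀ d, ‖ω.toPre (c * ω.ofPre d)‖ ≤ K * ‖d‖ := by
  refine Alg.induction (p := fun c => ∃ K, ∀ d, ‖ω.toPre (c * ω.ofPre d)‖ ≤ K * ‖d‖) ?_ ?_ ?_ c
  · intro i a
    refine ⟨‖a‖, fun d => ?_⟩
    let := CStarAlgebra.spectralOrder A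
    have := CStarAlgebra.spectralOrderedRing A
    obtain ⟨b, hb⟩ := CStarAlgebra.exists_eq_star_mul_self
      (sub_nonneg.mpr (CStarAlgebra.star_mul_le_algebraMap_norm_sq (a := a)))
    rw [← sq_le_sq₀ (norm_nonneg _) (by positivity), mul_pow, norm_sq, norm_sq, ofPre_toPre]
    have h1 : star (ι i a) * ι i a
        = ((‖a‖ ^ 2 : ℝ) : ℂ) • (1 : Alg A) - star (ι i b) * ι i b := by
      have h2 : star a * a = ((‖a‖ ^ 2 : ℝ) : ℂ) • (1 : A) - star b * b := by
        rw [← hb, Algebra.algebraMap_eq_smul_one, Complex.coe_smul, sub_sub_cancel]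
      rw [star_ι, ← map_mul, h2, map_sub, map_smul, map_one, map_mul, star_ι]
    have h3 := (RCLike.nonneg_iff.mp (ω.nonneg (ι i b * ω.ofPre d))).1
    have h4 : star (ι i a * ω.ofPre d) * (ι i a * ω.ofPre d)
        = ((‖a‖ ^ 2 : ℝ) : ℂ) • (star (ω.ofPre d) * ω.ofPre d)
          - star (ι i b * ω.ofPre d) * (ι i b * ω.ofPre d) := by
      rw [star_mul, mul_assoc, ← mul_assoc (star (ι i a)), h1, sub_mul, mul_sub, smul_mul_assoc,
        one_mul, mul_smul_comm, star_mul]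
      simp only [mul_assoc]
    rw [h4, map_sub, map_smul, Complex.sub_re, smul_eq_mul, Complex.re_ofReal_mul]
    exact sub_le_self _ h3
  · rintro c d ⟨K, hK⟩ ⟨L, hL⟩
    refine ⟨K + L, fun e => ?_⟩
    rw [add_mul, map_add, add_mul]
    exact (norm_add_le _ _).trans (add_le_add (hK e) (hL e))
  · rintro c d ⟨K, hK⟩ ⟨L, hL⟩
    -- The bound `K` carries no sign, hence the absolute value.
    refine ⟨|K| * L, fun e => ?_⟩
    rw [mul_assoc, mul_assoc]
    have h := hK (ω.toPre (d * ω.ofPre e))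
    rw [ofPre_toPre] at h
    exact h.trans ((mul_le_mul_of_nonneg_right (le_abs_self K) (norm_nonneg _)).trans
      (mul_le_mul_of_nonneg_left (hL e) (abs_nonneg K)))

/-- Left multiplication on the GNS space. -/
def leftMul (c : Alg A) : ω.PreGNS →L[ℂ] ω.PreGNS :=
  LinearMap.mkContinuousOfExistsBound
    (ω.toPre.toLinearMap ∘ₗ LinearMap.mulLeft ℂ c ∘ₗ ω.ofPre.toLinearMap) (ω.exists_bound c)

@[simp] theorem leftMul_apply (c : Alg A) (d : ω.PreGNS) :
    ω.leftMul c d = ω.toPre (c * ω.ofPre d) := rfl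

/-- The GNS space of a positive functional. -/
abbrev GNS : Type u := Completion ω.PreGNS

theorem ext_coe {S T : ω.GNS →L[ℂ] ω.GNS} (h : ∀ d : ω.PreGNS, S d = T d) : S = T := by
  ext d
  induction d using Completion.induction_on with
  | hp => exact isClosed_eq S.continuous T.continuous
  | ih d => exact h d

/-- The GNS representation of a positive functional on `A ∘ A`. -/
def rep : Alg A →⋆ₐ[ℂ] (ω.GNS →L[ℂ] ω.GNS) where
  toFun c := (ω.leftMul c).completion
  map_one' := ω.ext_coe fun d => by simp
  map_mul' c d := ω.ext_coe fun e => by simp [mul_assoc]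
  map_zero' := ω.ext_coe fun d => by simpa using Completion.coe_zero
  map_add' c d := ω.ext_coe fun e => by simp [add_mul, Completion.coe_add]
  commutes' z := ω.ext_coe fun d => by
    simp [Algebra.algebraMap_eq_smul_one, Completion.coe_smul]
  map_star' c := by
    refine (ContinuousLinearMap.eq_adjoint_iff (ω.leftMul (star c)).completion
      (ω.leftMul c).completion).mpr fun d e => ?_
    induction d, e using Completion.induction_on₂ with
    | hp => apply isClosed_eq <;> fun_prop
    | ih d e => simp [mul_assoc, inner_def]

@[simp] theorem rep_coe (c : Alg A) (d : ω.PreGNS) :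
    ω.rep c d = (ω.toPre (c * ω.ofPre d) : ω.PreGNS) :=
  ContinuousLinearMap.completion_apply_coe _ _

/-- The GNS representation is evaluated at the class of `1`. Its space is built on `A ∘ A` and so
lies in `Type u`, the universe over which the universal norm takes its supremum. -/
theorem le_norm_sq (c : Alg A) : (ω (star c * c)).re ≤ ‖c‖ ^ 2 * (ω 1).re := by
  have h := (ω.rep c).le_of_opNorm_le (norm_rep_le ω.rep c) (ω.toPre 1)
  rw [rep_coe, ofPre_toPre, mul_one, Completion.norm_coe, Completion.norm_coe] at h
  have h2 := pow_le_pow_left₀ (norm_nonneg _) h 2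
  rw [mul_pow, norm_sq, norm_sq, ofPre_toPre, ofPre_toPre, star_one, mul_one] at h2
  exact h2

end PositiveFunctional

end

end CStarFree.Alg

/-! ### Representations on Hilbert modules and their extension to `A * A` -/

namespace HilbertModule

open MulOpposite CStarModule CStarFree
open scoped CStarAlgebra ComplexOrder

noncomputable section

variable {B : Type v} [CStarAlgebra B] [PartialOrder B] [StarOrderedRing B]
  {E : Type*} [NormedAddCommGroup E] [NormedSpace ℂ E] [Module Bᵐᵒᵖ E] [CStarModule Bᵐᵒᵖ E]

theorem norm_sq_eq_norm_innerB (x : E) : ‖x‖ ^ 2 = ‖innerB B x x‖ := by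
  rw [CStarModule.norm_sq_eq Bᵐᵒᵖ, innerB, MulOpposite.norm_unop]

theorem continuous_innerB : Continuous fun p : E × E => innerB B p.1 p.2 :=
  MulOpposite.continuous_unop.comp (CStarModule.continuous_inner (A := Bᵐᵒᵖ))

theorem _root_.Continuous.innerB {X : Type*} [TopologicalSpace X] {f g : X → E}
    (hf : Continuous f) (hg : Continuous g) : Continuous fun t => innerB B (f t) (g t) :=
  continuous_innerB.comp (hf.prodMk hg)

variable (B) in
/-- The `B`-valued inner product as a linear map in the second variable. -/
def innerBₗ (x : E) : E →ₗ[ℂ] B where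
  toFun := innerB B x
  map_add' := innerB_add_right x
  map_smul' z y := innerB_complex_smul_right z x y

theorem innerBₗ_apply (x y : E) : innerBₗ B x y = innerB B x y := rfl

theorem innerB_smul_left (b : B) (x y : E) : innerB B (op b • x) y = star b * innerB B x y := by
  rw [← star_innerB, innerB_smul_right, star_mul, star_innerB]

theorem innerB_sum_right {ι : Type*} (s : Finset ι) (x : E) (f : ι → E) :
    innerB B x (∑ i ∈ s, f i) = ∑ i ∈ s, innerB B x (f i) :=
  map_sum (innerBₗ B x) f s

theorem innerB_sum_left {ι : Type*} (s : Finset ι) (f : ι → E) (y : E) :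
    innerB B (∑ i ∈ s, f i) y = ∑ i ∈ s, innerB B (f i) y := by
  rw [← star_innerB, innerB_sum_right, star_sum]
  exact Finset.sum_congr rfl fun i _ => star_innerB _ _

/-- Adjointable operators are right `B`-linear. -/
theorem adjointable_apply_smul (T : adjointable B E) (b : B) (y : E) :
    T.1 (op b • y) = op b • T.1 y :=
  innerB_ext (B := B) fun z => by
    rw [innerB_smul_right, ← star_innerB, innerB_apply_left, star_innerB, innerB_smul_right,
      ← star_innerB (B := B) (T.1 y), innerB_apply_left, star_innerB, star_star]

theorem innerB_apply_apply (T S : adjointable B E) (x y : E) :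
    innerB B (T.1 x) (S.1 y) = innerB B x ((star T * S).1 y) :=
  innerB_apply_left T x (S.1 y)

theorem adjointable_one_apply (y : E) : (1 : adjointable B E).1 y = y := rfl

theorem adjointable_mul_apply (T S : adjointable B E) (y : E) : (T * S).1 y = T.1 (S.1 y) := rfl

theorem adjointable_add_apply (T S : adjointable B E) (y : E) :
    (T + S).1 y = T.1 y + S.1 y := rfl

theorem adjointable_smul_apply (z : ℂ) (T : adjointable B E) (y : E) :
    (z • T).1 y = z • T.1 y := rfl

section CStarDomain

variable {C : Type*} [CStarAlgebra C] (σ : C →⋆ₐ[ℂ] adjointable B E)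

/-- With `‖c‖² - c* c = d* d`, the difference of the two sides is `⟪σ d y, σ d y⟫`. Neither
completeness of `E` nor a C*-norm on the adjointable operators is involved. -/
theorem innerB_rep_le (c : C) (y : E) :
    innerB B ((σ c).1 y) ((σ c).1 y) ≤ ((‖c‖ ^ 2 : ℝ) : ℂ) • innerB B y y := by
  let := CStarAlgebra.spectralOrder C
  have := CStarAlgebra.spectralOrderedRing C
  obtain ⟨d, hd⟩ := CStarAlgebra.exists_eq_star_mul_self
    (sub_nonneg.mpr (CStarAlgebra.star_mul_le_algebraMap_norm_sq (a := c)))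
  have h2 : star c * c = ((‖c‖ ^ 2 : ℝ) : ℂ) • (1 : C) - star d * d := by
    rw [← hd, Algebra.algebraMap_eq_smul_one, Complex.coe_smul, sub_sub_cancel]
  have h3 : innerB B ((σ c).1 y) ((σ c).1 y)
      = ((‖c‖ ^ 2 : ℝ) : ℂ) • innerB B y y - innerB B ((σ d).1 y) ((σ d).1 y) := by
    rw [innerB_apply_apply, innerB_apply_apply, ← map_star, ← map_star, ← map_mul, ← map_mul, h2,
      map_sub, map_smul, map_one, ← innerBₗ_apply, ← innerBₗ_apply, ← innerBₗ_apply, ← map_smul,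
      ← map_sub]
    rfl
  rw [h3]
  exact sub_le_self _ (innerB_self_nonneg _)

theorem norm_rep_apply_le (c : C) (y : E) : ‖(σ c).1 y‖ ≤ ‖c‖ * ‖y‖ := by
  rw [← sq_le_sq₀ (norm_nonneg _) (by positivity), mul_pow,
    norm_sq_eq_norm_innerB (B := B) ((σ c).1 y), norm_sq_eq_norm_innerB (B := B) y]
  refine (CStarAlgebra.norm_le_norm_of_nonneg_of_le (innerB_self_nonneg _)
    (innerB_rep_le σ c y)).trans ?_
  rw [norm_smul, Complex.norm_real, Real.norm_of_nonneg (by positivity)]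

theorem continuous_rep_apply (y : E) : Continuous fun c => (σ c).1 y := by
  let f : C →ₗ[ℂ] E :=
    { toFun := fun c => (σ c).1 y
      map_add' := fun c d => by rw [map_add]; rfl
      map_smul' := fun z c => by rw [map_smul]; rfl }
  exact (f.mkContinuous ‖y‖ fun c => by
    rw [mul_comm]; exact norm_rep_apply_le σ c y).continuous

end CStarDomain

section Alg

variable {A : Type u} [CStarAlgebra A] (π : Alg A →⋆ₐ[ℂ] adjointable B E)

/-- The positive functional `c ↦ f ⟪y, π c y⟫`. -/
def vectorFunctional (f : B →ₗ[ℂ] ℂ) (hpos : ∀ b, 0 ≤ b → 0 ≤ f b)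
    (hstar : ∀ b, f (star b) = conj (f b)) (y : E) : Alg.PositiveFunctional A where
  toLinearMap :=
    { toFun := fun c => f (innerB B y ((π c).1 y))
      map_add' := fun c d => by
        rw [map_add, adjointable_add_apply, innerB_add_right, map_add]
      map_smul' := fun z c => by
        rw [map_smul, adjointable_smul_apply, innerB_complex_smul_right, map_smul]; rfl }
  map_star c := by
    change f (innerB B y ((π (star c)).1 y)) = conj (f (innerB B y ((π c).1 y)))
    rw [map_star, ← hstar, star_innerB, innerB_apply_left]
  nonneg c := by
    change 0 ≤ f (innerB B y ((π (star c * c)).1 y))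
    rw [map_mul, map_star, ← innerB_apply_apply]
    exact hpos _ (innerB_self_nonneg _)

/-- Representations of `A ∘ A` on Hilbert modules are contractive for the universal norm. -/
theorem norm_algRep_apply_le (c : Alg A) (y : E) : ‖(π c).1 y‖ ≤ ‖c‖ * ‖y‖ := by
  rw [← sq_le_sq₀ (norm_nonneg _) (by positivity), mul_pow]
  -- The functional `f` attains `‖π c y‖²` at `⟪π c y, π c y⟫`, so the scalar GNS bound loses
  -- nothing.
  obtain ⟨f, hpos, hstar, hnorm, hle⟩ := CStarAlgebra.exists_positive_functional
    (innerB_self_nonneg (B := B) ((π c).1 y))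
  have h := (vectorFunctional π f hpos hstar y).le_norm_sq c
  have h1 : vectorFunctional π f hpos hstar y (star c * c) = (‖(π c).1 y‖ ^ 2 : ℝ) := by
    rw [norm_sq_eq_norm_innerB (B := B), ← hnorm, innerB_apply_apply, ← map_star, ← map_mul]
    rfl
  have h2 : (vectorFunctional π f hpos hstar y 1).re ≤ ‖y‖ ^ 2 := by
    have : vectorFunctional π f hpos hstar y 1 = f (innerB B y y) := by
      change f (innerB B y ((π 1).1 y)) = _
      rw [map_one]; rfl
    rw [this, norm_sq_eq_norm_innerB (B := B)]
    exact (Complex.re_le_norm _).trans (hle _)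
  rw [h1, Complex.ofReal_re] at h
  exact h.trans (mul_le_mul_of_nonneg_left h2 (by positivity))

theorem denseRange_of : DenseRange (Full.of (A := A)) :=
  UniformSpace.Completion.denseRange_coe (α := Alg A)

/-- The underlying linear map of a representation. -/
def algRepLinear : Alg A →ₗ[ℂ] (E →L[ℂ] E) :=
  (adjointable B E).val.toLinearMap ∘ₗ (π : Alg A →ₐ[ℂ] adjointable B E).toLinearMap

/-- A bound by `‖Full.of c‖` lets `π` factor through `Full.of`, whose injectivity is not needed. -/
theorem norm_algRepLinear_le (c : Alg A) : ‖algRepLinear π c‖ ≤ 1 * ‖Full.of c‖ := by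
  rw [one_mul, Full.norm_of]
  exact ContinuousLinearMap.opNorm_le_bound _ (norm_nonneg c) (norm_algRep_apply_le π c)

variable [CompleteSpace E]

/-- The continuous extension of a representation to the full free product. -/
def extendLinear : Full A →L[ℂ] (E →L[ℂ] E) :=
  (algRepLinear π).extendOfNorm (Full.of (A := A)).toLinearMap

theorem extendLinear_of (c : Alg A) : extendLinear π (Full.of c) = (π c).1 :=
  LinearMap.extendOfNorm_eq (f := algRepLinear π) (e := (Full.of (A := A)).toLinearMap)
    denseRange_of ⟨1, norm_algRepLinear_le π⟩ c

theorem innerB_extendLinear (c : Full A) (x y : E) :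
    innerB B (extendLinear π c x) y = innerB B x (extendLinear π (star c) y) := by
  refine Full.induction (p := fun c => innerB B (extendLinear π c x) y
    = innerB B x (extendLinear π (star c) y)) (isClosed_eq ?_ ?_) (fun c => ?_) c
  · exact Continuous.innerB (by fun_prop) continuous_const
  · have := Full.continuous_star' (A := A)
    exact Continuous.innerB continuous_const (by fun_prop)
  · rw [Full.star_of, extendLinear_of, extendLinear_of, map_star, innerB_apply_left]

/-- The extension of a representation of `A ∘ A` to the full free product. -/
def extendRep : Full A →⋆ₐ[ℂ] adjointable B E where
  toFun c := ⟨extendLinear π c, extendLinear π (star c), innerB_extendLinear π c⟩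
  map_one' := Subtype.ext <| by
    change extendLinear π 1 = 1
    rw [← map_one Full.of, extendLinear_of, map_one]; rfl
  map_mul' c d := Subtype.ext <| by
    change extendLinear π (c * d) = extendLinear π c * extendLinear π d
    refine Full.induction (p := fun c => extendLinear π (c * d)
      = extendLinear π c * extendLinear π d) (isClosed_eq (by fun_prop) (by fun_prop))
      (fun c => ?_) c
    refine Full.induction (p := fun d => extendLinear π (Full.of c * d)
      = extendLinear π (Full.of c) * extendLinear π d) (isClosed_eq (by fun_prop) (by fun_prop))
      (fun d => ?_) d
    rw [← map_mul, extendLinear_of, extendLinear_of, extendLinear_of, map_mul]; rfl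
  map_zero' := Subtype.ext (map_zero (extendLinear π))
  map_add' c d := Subtype.ext (map_add (extendLinear π) c d)
  commutes' z := Subtype.ext <| by
    change extendLinear π (algebraMap ℂ (Full A) z) = algebraMap ℂ (E →L[ℂ] E) z
    rw [← AlgHom.commutes Full.of, extendLinear_of, AlgHomClass.commutes π]; rfl
  map_star' c := (adjoint_unique fun x y => innerB_extendLinear π c x y).symm

theorem extendRep_of (c : Alg A) : extendRep π (Full.of c) = π c :=
  Subtype.ext (extendLinear_of π c)

end Alg

section Pair

variable {A : Type u} [CStarAlgebra A]

/-- The representation of `A ∘ A` given by a pair of representations of `A`. -/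
def algRep (s : Fin 2 → (A →⋆ₐ[ℂ] adjointable B E)) : Alg A →⋆ₐ[ℂ] adjointable B E :=
  { Alg.lift fun i => (s i : A →ₐ[ℂ] adjointable B E) with
    map_star' := fun c => by
      change Alg.lift (fun i => (s i : A →ₐ[ℂ] adjointable B E)) (star c)
        = star (Alg.lift (fun i => (s i : A →ₐ[ℂ] adjointable B E)) c)
      induction c using Alg.induction with
      | hι i a =>
        rw [Alg.star_ι, Alg.lift_ι, Alg.lift_ι]
        exact map_star (s i) a
      | hadd c d hc hd => rw [star_add, map_add, hc, hd, map_add, star_add]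
      | hmul c d hc hd => rw [star_mul, map_mul, hc, hd, map_mul, star_mul] }

theorem algRep_ι (s : Fin 2 → (A →⋆ₐ[ℂ] adjointable B E)) (i : Fin 2) (a : A) :
    algRep s (Alg.ι i a) = s i a :=
  Alg.lift_ι _ i a

/-- Agreement on `A ∘ A` is the universal property; strong continuity carries it to the completion.
-/
theorem fullRep_ext {σ τ : Full A →⋆ₐ[ℂ] adjointable B E}
    (h : ∀ i a, σ (Full.ρ i a) = τ (Full.ρ i a)) : σ = τ := by
  have h1 : (σ : Full A →ₐ[ℂ] adjointable B E).comp Full.of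
      = (τ : Full A →ₐ[ℂ] adjointable B E).comp Full.of := Alg.hom_ext h
  ext c y
  refine Full.induction (p := fun c => (σ c).1 y = (τ c).1 y)
    (isClosed_eq (continuous_rep_apply σ y) (continuous_rep_apply τ y)) (fun c => ?_) c
  have : σ (Full.of c) = τ (Full.of c) := DFunLike.congr_fun h1 c
  rw [this]

end Pair

end

end HilbertModule

/-! ### Completion of a semi-inner-product module -/

namespace HilbertModule

open MulOpposite UniformSpace

noncomputable section

/-- A positive semidefinite `B`-valued sesquilinear form on a right `B`-module, linear in the
second variable. -/
structure PreInner (B : Type*) (P : Type*) [CStarAlgebra B] [PartialOrder B] [StarOrderedRing B]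
    [AddCommGroup P] [Module ℂ P] [Module Bᵐᵒᵖ P] where
  form : P → P → B
  form_add_right : ∀ x y z, form x (y + z) = form x y + form x z
  form_smul_right : ∀ (z : ℂ) x y, form x (z • y) = z • form x y
  form_op_smul_right : ∀ x y (b : B), form x (op b • y) = form x y * b
  star_form : ∀ x y, star (form x y) = form y x
  form_self_nonneg : ∀ x, 0 ≤ form x x

namespace PreInner

variable {B : Type*} {P : Type*} [CStarAlgebra B] [PartialOrder B] [StarOrderedRing B]
    [AddCommGroup P] [Module ℂ P] [Module Bᵐᵒᵖ P] (g : PreInner B P)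

theorem form_add_left (x y z : P) : g.form (x + y) z = g.form x z + g.form y z := by
  rw [← g.star_form, form_add_right, star_add, star_form, star_form]

theorem form_smul_left (z : ℂ) (x y : P) : g.form (z • x) y = conj z • g.form x y := by
  rw [← g.star_form, form_smul_right, star_smul, star_form]; rfl

theorem form_op_smul_left (b : B) (x y : P) : g.form (op b • x) y = star b * g.form x y := by
  rw [← g.star_form, form_op_smul_right, star_mul, star_form]

/-- The form, as a sesquilinear map. -/
def formₛₗ : P →ₗ⋆[ℂ] P →ₗ[ℂ] B :=
  LinearMap.mk₂'ₛₗ (starRingEnd ℂ) (RingHom.id ℂ) g.form g.form_add_left g.form_smul_left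
    g.form_add_right g.form_smul_right

theorem formₛₗ_apply (x y : P) : g.formₛₗ x y = g.form x y := rfl

/-- Cauchy–Schwarz, from positivity of the form at `t⁻¹ x a - y` with `a = ⟪x, y⟫`, which yields
`t⁻¹ a* a ≤ ⟪y, y⟫`. The number `t > 0` stands in for `‖⟪x, x⟫‖`, which may vanish. -/
theorem norm_form_sq_le_of_lt {x y : P} {t : ℝ} (ht : 0 < t) (hx : ‖g.form x x‖ ≤ t) :
    ‖g.form x y‖ ^ 2 ≤ t * ‖g.form y y‖ := by
  set a := g.form x y with ha
  have h1 := g.form_self_nonneg (((t⁻¹ : ℝ) : ℂ) • (op a • x) - y)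
  have h2 : g.form (((t⁻¹ : ℝ) : ℂ) • (op a • x) - y) (((t⁻¹ : ℝ) : ℂ) • (op a • x) - y)
      = (t⁻¹ * t⁻¹) • (star a * g.form x x * a) - t⁻¹ • (star a * a) - t⁻¹ • (star a * a)
        + g.form y y := by
    simp only [← formₛₗ_apply, map_sub, LinearMap.sub_apply, map_smul, LinearMap.map_smulₛₗ,
      LinearMap.smul_apply, Complex.conj_ofReal]
    simp only [formₛₗ_apply, form_op_smul_left, form_op_smul_right, ← ha,
      ← g.star_form x y, Complex.coe_smul, mul_assoc]
    rw [smul_sub, smul_smul]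
    abel
  have h3 : star a * g.form x x * a ≤ t • (star a * a) :=
    (CStarAlgebra.star_left_conjugate_le_norm_smul
      (hb := .of_nonneg (g.form_self_nonneg x))).trans
      (smul_le_smul_of_nonneg_right hx (star_mul_self_nonneg a))
  have h4 : (t⁻¹ * t⁻¹) • (star a * g.form x x * a) ≤ t⁻¹ • (star a * a) := by
    refine (smul_le_smul_of_nonneg_left h3 (by positivity)).trans_eq ?_
    rw [smul_smul, mul_assoc, inv_mul_cancel₀ ht.ne', mul_one]
  have h5 : t⁻¹ • (star a * a) ≤ g.form y y := by
    rw [h2] at h1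
    have h6 := h1.trans (add_le_add_left (sub_le_sub_right (sub_le_sub_right h4 _) _) _)
    rw [sub_self, zero_sub, neg_add_eq_sub] at h6
    exact sub_nonneg.mp h6
  have h6 := CStarAlgebra.norm_le_norm_of_nonneg_of_le
    (smul_nonneg (by positivity) (star_mul_self_nonneg a)) h5
  rw [norm_smul, CStarRing.norm_star_mul_self, Real.norm_of_nonneg (by positivity),
    inv_mul_le_iff₀ ht, ← sq] at h6
  exact h6

theorem norm_form_sq_le (x y : P) : ‖g.form x y‖ ^ 2 ≤ ‖g.form x x‖ * ‖g.form y y‖ := by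
  refine le_of_forall_pos_le_add fun δ hδ => ?_
  -- The excess over `‖⟪x, x⟫‖`, multiplied by `‖⟪y, y⟫‖`, stays below `δ`; the `+ 1` avoids
  -- division by zero.
  have h := g.norm_form_sq_le_of_lt (x := x) (y := y) (t := ‖g.form x x‖ + δ / (‖g.form y y‖ + 1))
    (by positivity) (by linarith [show 0 ≤ δ / (‖g.form y y‖ + 1) by positivity])
  refine h.trans ?_
  rw [add_mul]
  gcongr
  rw [div_mul_eq_mul_div, div_le_iff₀ (by positivity)]
  nlinarith [norm_nonneg (g.form y y)]

/-- The module, normed by the form. -/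
def Space (_ : PreInner B P) : Type _ := P

instance : AddCommGroup g.Space := inferInstanceAs (AddCommGroup P)
instance : Module ℂ g.Space := inferInstanceAs (Module ℂ P)
instance : Module Bᵐᵒᵖ g.Space := inferInstanceAs (Module Bᵐᵒᵖ P)

/-- The identification of the module with the normed module. -/
def toSpace : P ≃ₗ[ℂ] g.Space := LinearEquiv.refl ℂ P

instance : Norm g.Space := ⟨fun x => √‖g.form x x‖⟩

theorem norm_def (x : g.Space) : ‖x‖ = √‖g.form x x‖ := rfl

theorem norm_sq (x : g.Space) : ‖x‖ ^ 2 = ‖g.form x x‖ := Real.sq_sqrt (norm_nonneg _)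

theorem norm_form_le (x y : g.Space) : ‖g.form x y‖ ≤ ‖x‖ * ‖y‖ := by
  rw [norm_def, norm_def, ← Real.sqrt_mul (norm_nonneg _)]
  exact Real.le_sqrt_of_sq_le (g.norm_form_sq_le x y)

theorem seminormedCore : SeminormedSpace.Core ℂ g.Space where
  norm_nonneg x := Real.sqrt_nonneg _
  norm_smul z x := by
    have h : g.form (z • x) (z • x) = conj z • z • g.form x x :=
      (g.form_smul_left z x (z • x : P)).trans (congrArg _ (g.form_smul_right z x x))
    rw [norm_def, norm_def, h, norm_smul, norm_smul, Complex.norm_conj, ← mul_assoc,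
      Real.sqrt_mul (mul_self_nonneg _), Real.sqrt_mul_self (norm_nonneg z)]
  norm_triangle x y := by
    rw [norm_def (x := x + y)]
    refine Real.sqrt_le_iff.mpr ⟨add_nonneg (Real.sqrt_nonneg _) (Real.sqrt_nonneg _), ?_⟩
    have h : g.form (x + y) (x + y) = g.form x x + g.form x y + (g.form y x + g.form y y) :=
      (g.form_add_left x y (x + y : P)).trans
        (congrArg₂ _ (g.form_add_right x x y) (g.form_add_right y x y))
    rw [h]
    have h1 := norm_add_le (g.form x x + g.form x y) (g.form y x + g.form y y)
    have h2 := norm_add_le (g.form x x) (g.form x y)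
    have h3 := norm_add_le (g.form y x) (g.form y y)
    have h4 := g.norm_form_le x y
    have h5 := g.norm_form_le y x
    have h6 := g.norm_sq x
    have h7 := g.norm_sq y
    nlinarith

instance : SeminormedAddCommGroup g.Space := SeminormedAddCommGroup.ofCore g.seminormedCore
instance : NormedSpace ℂ g.Space := { norm_smul_le := fun z x => (g.seminormedCore.norm_smul z x).le }

theorem norm_op_smul_le (b : B) (x : g.Space) : ‖op b • x‖ ≤ ‖b‖ * ‖x‖ := by
  rw [← sq_le_sq₀ (norm_nonneg _) (by positivity), mul_pow, norm_sq, norm_sq]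
  have h : g.form (op b • x) (op b • x) = star b * (g.form x x * b) :=
    (g.form_op_smul_left b x (op b • x : P)).trans (congrArg _ (g.form_op_smul_right x x b))
  rw [h]
  calc _ ≤ ‖star b‖ * (‖g.form x x‖ * ‖b‖) :=
        (norm_mul_le _ _).trans (mul_le_mul_of_nonneg_left (norm_mul_le _ _) (norm_nonneg _))
    _ = ‖b‖ ^ 2 * ‖g.form x x‖ := by rw [norm_star]; ring

instance : UniformContinuousConstSMul Bᵐᵒᵖ g.Space where
  uniformContinuous_const_smul b :=
    (AddMonoidHomClass.lipschitz_of_bound (DistribSMul.toAddMonoidHom g.Space b) ‖unop b‖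
      fun x => g.norm_op_smul_le (unop b) x).uniformContinuous

instance : Inner Bᵐᵒᵖ g.Space := ⟨fun x y => op (g.form x y)⟩

/-- The form, as a continuous sesquilinear map. -/
def formSL : g.Space →L⋆[ℂ] g.Space →L[ℂ] B :=
  LinearMap.mkContinuous₂ (show g.Space →ₗ⋆[ℂ] g.Space →ₗ[ℂ] B from g.formₛₗ) 1 fun x y => by
    rw [one_mul]; exact g.norm_form_le x y

theorem continuous_form : Continuous fun p : g.Space × g.Space => op (g.form p.1 p.2) :=
  MulOpposite.continuous_op.comp
    (show Continuous fun p : g.Space × g.Space => g.formSL p.1 p.2 by fun_prop)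

/-- The Hilbert module completion. -/
abbrev Compl : Type _ := Completion g.Space

theorem inner_coe (x y : g.Space) : inner Bᵐᵒᵖ (x : g.Compl) (y : g.Compl) = op (g.form x y) :=
  (Completion.isDenseInducing_coe.prodMap Completion.isDenseInducing_coe).extend_eq
    g.continuous_form (x, y)

/-- The form need not be uniformly continuous in both variables jointly; it extends continuously
because it is biadditive. -/
theorem continuous_inner :
    Continuous (Function.uncurry (inner Bᵐᵒᵖ : g.Compl → g.Compl → Bᵐᵒᵖ)) := by
  let f : g.Space →+ g.Space →+ Bᵐᵒᵖ :=
    AddMonoidHom.mk' (fun x => AddMonoidHom.mk' (fun y => op (g.form x y))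
      fun y z => congrArg op (g.form_add_right x y z))
      fun x y => AddMonoidHom.ext fun z => congrArg op (g.form_add_left x y z)
  have hf : Continuous fun p : g.Space × g.Space => f p.1 p.2 := g.continuous_form
  exact (Completion.isDenseInducing_toCompl g.Space).extend_Z_bilin
    (Completion.isDenseInducing_toCompl g.Space) hf

theorem _root_.Continuous.preInner {X : Type*} [TopologicalSpace X] {s t : X → g.Compl}
    (hs : Continuous s) (ht : Continuous t) : Continuous fun w => inner Bᵐᵒᵖ (s w) (t w) :=
  g.continuous_inner.comp (hs.prodMk ht)

theorem norm_sq_compl (x : g.Compl) : ‖x‖ ^ 2 = ‖inner Bᵐᵒᵖ x x‖ := by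
  induction x using Completion.induction_on with
  | hp => exact isClosed_eq (by fun_prop) (Continuous.preInner g continuous_id continuous_id).norm
  | ih x => rw [Completion.norm_coe, inner_coe, norm_sq, MulOpposite.norm_op]

theorem continuous_op_smul (b : Bᵐᵒᵖ) : Continuous fun x : g.Compl => b • x :=
  (UniformContinuousConstSMul.uniformContinuous_const_smul b).continuous

theorem continuous_smul_op (z : ℂ) : Continuous fun w : Bᵐᵒᵖ => z • w :=
  MulOpposite.continuous_op.comp (MulOpposite.continuous_unop.const_smul z)

theorem continuous_mul_left_op (b : Bᵐᵒᵖ) : Continuous fun z : Bᵐᵒᵖ => b * z :=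
  MulOpposite.continuous_op.comp (MulOpposite.continuous_unop.mul continuous_const)

instance : CStarModule Bᵐᵒᵖ g.Compl where
  inner_add_right {x y z} := by
    induction x, y, z using Completion.induction_on₃ with
    | hp =>
      exact isClosed_eq (Continuous.preInner g (by fun_prop) (by fun_prop))
        ((Continuous.preInner g (by fun_prop) (by fun_prop)).add
          (Continuous.preInner g (by fun_prop) (by fun_prop)))
    | ih x y z =>
      rw [← Completion.coe_add, inner_coe, inner_coe, inner_coe]
      exact congrArg op (g.form_add_right x y z)
  inner_self_nonneg {x} := by
    induction x using Completion.induction_on with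
    | hp => exact isClosed_le continuous_const (Continuous.preInner g continuous_id continuous_id)
    | ih x => rw [inner_coe]; exact g.form_self_nonneg x
  -- The completion is separated, so null vectors have been identified with zero and definiteness is
  -- that of the norm.
  inner_self {x} := by
    rw [← norm_eq_zero, ← g.norm_sq_compl, sq_eq_zero_iff, norm_eq_zero]
  inner_op_smul_right {b x y} := by
    induction x, y using Completion.induction_on₂ with
    | hp =>
      exact isClosed_eq
        (Continuous.preInner g continuous_fst ((g.continuous_op_smul b).comp continuous_snd))
        ((continuous_mul_left_op b).comp g.continuous_inner)
    | ih x y =>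
      rw [← Completion.coe_smul, inner_coe, inner_coe]
      exact congrArg op (g.form_op_smul_right x y (unop b))
  inner_smul_right_complex {z x y} := by
    induction x, y using Completion.induction_on₂ with
    | hp =>
      exact isClosed_eq (Continuous.preInner g continuous_fst (continuous_snd.const_smul z))
        ((continuous_smul_op z).comp g.continuous_inner)
    | ih x y =>
      rw [← Completion.coe_smul, inner_coe, inner_coe]
      exact congrArg op (g.form_smul_right z x y)
  star_inner x y := by
    induction x, y using Completion.induction_on₂ with
    | hp =>
      exact isClosed_eq (continuous_star.comp (Continuous.preInner g (by fun_prop) (by fun_prop)))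
        (Continuous.preInner g (by fun_prop) (by fun_prop))
    | ih x y =>
      rw [inner_coe, inner_coe]
      exact congrArg op (g.star_form x y)
  norm_eq_sqrt_norm_inner_self x := by
    rw [← g.norm_sq_compl, Real.sqrt_sq (norm_nonneg x)]

theorem innerB_coe (x y : g.Space) : innerB B (x : g.Compl) (y : g.Compl) = g.form x y :=
  congrArg unop (g.inner_coe x y)

end PreInner

end

end HilbertModule

/-! ### Orbit maps, vector states and the KSGNS construction -/

namespace HilbertModule

open MulOpposite UniformSpace
open scoped CStarAlgebra

noncomputable section

variable {B : Type*} [CStarAlgebra B] [PartialOrder B] [StarOrderedRing B]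
  {C : Type*} [CStarAlgebra C]

/-- The map `c ⊗ b ↦ a c ⊗ b`. -/
def leftMul (a : C) : (C →₀ B) →ₗ[ℂ] (C →₀ B) := Finsupp.lmapDomain B ℂ fun c => a * c

theorem leftMul_single (a c : C) (b : B) :
    leftMul a (Finsupp.single c b) = Finsupp.single (a * c) b :=
  Finsupp.mapDomain_single

theorem leftMul_one (x : C →₀ B) : leftMul 1 x = x := by
  simp only [leftMul, one_mul]
  exact Finsupp.mapDomain_id

theorem leftMul_mul (a c : C) (x : C →₀ B) : leftMul (a * c) x = leftMul a (leftMul c x) := by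
  simp only [leftMul, mul_assoc]
  exact Finsupp.mapDomain_comp

section VectorState

variable {E : Type*} [NormedAddCommGroup E] [NormedSpace ℂ E] [Module Bᵐᵒᵖ E] [CStarModule Bᵐᵒᵖ E]
  (σ : C →⋆ₐ[ℂ] adjointable B E) (x : E)

/-- The linear map `b ↦ x b`. -/
def rightMul : B →ₗ[ℂ] E where
  toFun b := op b • x
  map_add' b c := by rw [op_add, add_smul]
  -- Compatibility of the actions of `ℂ` and `Bᵐᵒᵖ` is not an assumption; the inner product enforces
  -- it.
  map_smul' z b := innerB_ext (B := B) fun y => by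
    rw [innerB_smul_right, RingHom.id_apply, innerB_complex_smul_right, innerB_smul_right,
      mul_smul_comm]

/-- The linear map `c ⊗ b ↦ σ c (x b)`. -/
def orbitMap : (C →₀ B) →ₗ[ℂ] E :=
  Finsupp.lsum ℂ fun c => (σ c).1.toLinearMap ∘ₗ rightMul x

theorem orbitMap_apply (f : C →₀ B) : orbitMap σ x f = f.sum fun c b => (σ c).1 (op b • x) := rfl

theorem orbitMap_single (c : C) (b : B) :
    orbitMap σ x (Finsupp.single c b) = (σ c).1 (op b • x) := by
  rw [orbitMap_apply, Finsupp.sum_single_index]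
  exact map_zero ((σ c).1.toLinearMap ∘ₗ rightMul x)

/-- Inner products of orbit vectors depend only on `c ↦ ⟪x, σ c x⟫`. Both the complete positivity of
that map and the uniqueness of the cyclic representation rest on this. -/
theorem innerB_orbit (a c : C) (b d : B) :
    innerB B ((σ a).1 (op b • x)) ((σ c).1 (op d • x))
      = star b * innerB B x ((σ (star a * c)).1 x) * d := by
  rw [adjointable_apply_smul, adjointable_apply_smul, innerB_smul_left, innerB_smul_right,
    innerB_apply_apply, map_mul, map_star, mul_assoc]

theorem innerB_orbitMap (f g : C →₀ B) :
    innerB B (orbitMap σ x f) (orbitMap σ x g) = f.sum fun a b => g.sum fun c d =>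
      star b * innerB B x ((σ (star a * c)).1 x) * d := by
  simp only [orbitMap_apply, Finsupp.sum, innerB_sum_left, innerB_sum_right, innerB_orbit]
  exact Finset.sum_comm

theorem denseRange_orbitMap_iff :
    DenseRange (orbitMap σ x) ↔
      (Submodule.span ℂ {y : E | ∃ (c : C) (b : B), y = (σ c).1 (op b • x)}).topologicalClosure
        = ⊤ := by
  have h : Submodule.span ℂ {y : E | ∃ (c : C) (b : B), y = (σ c).1 (op b • x)}
      = LinearMap.range (orbitMap σ x) := by
    refine le_antisymm (Submodule.span_le.mpr ?_) ?_
    · rintro _ ⟨c, b, rfl⟩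
      exact ⟨Finsupp.single c b, orbitMap_single σ x c b⟩
    · rintro _ ⟨f, rfl⟩
      rw [orbitMap_apply]
      exact Submodule.sum_mem _ fun c _ => Submodule.subset_span ⟨c, f c, rfl⟩
  rw [h, ← Submodule.dense_iff_topologicalClosure_eq_top]
  rfl

variable [PartialOrder C] [StarOrderedRing C]

/-- The completely positive map `c ↦ ⟪x, σ c x⟫`. -/
def vectorMap : C →CP B :=
  CompletelyPositiveMap.ofSumNonneg
    { toFun := fun c => innerB B x ((σ c).1 x)
      map_add' := fun c d => by rw [map_add, adjointable_add_apply, innerB_add_right]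
      map_smul' := fun z c => by
        rw [map_smul, adjointable_smul_apply, innerB_complex_smul_right]; rfl }
    (fun c => by
      change innerB B x ((σ (star c)).1 x) = star (innerB B x ((σ c).1 x))
      rw [map_star, star_innerB, innerB_apply_left])
    (fun k a b => by
      have h : ∑ i, ∑ j, star (b i) * innerB B x ((σ (star (a i) * a j)).1 x) * b j
          = innerB B (∑ i, (σ (a i)).1 (op (b i) • x)) (∑ i, (σ (a i)).1 (op (b i) • x)) := by
        simp only [innerB_sum_left, innerB_sum_right, innerB_orbit]
        exact Finset.sum_comm
      exact (innerB_self_nonneg (B := B) _).trans_eq h.symm)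

theorem vectorMap_apply (c : C) : vectorMap σ x c = innerB B x ((σ c).1 x) := rfl

end VectorState

section Unitary

variable {E F : Type*}
  [NormedAddCommGroup E] [NormedSpace ℂ E] [Module Bᵐᵒᵖ E] [CStarModule Bᵐᵒᵖ E] [CompleteSpace E]
  [NormedAddCommGroup F] [NormedSpace ℂ F] [Module Bᵐᵒᵖ F] [CStarModule Bᵐᵒᵖ F] [CompleteSpace F]

/-- The hypothesis gives `‖j p‖ = ‖k p‖`, so `j p ↦ k p` is well defined and isometric between dense
subspaces. -/
theorem exists_unitary {P : Type*} [AddCommGroup P] [Module ℂ P] (j : P →ₗ[ℂ] E) (k : P →ₗ[ℂ] F)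
    (hj : DenseRange j) (hk : DenseRange k)
    (h : ∀ p q, innerB B (j p) (j q) = innerB B (k p) (k q)) :
    ∃ U : E ≃L[ℂ] F, (∀ p, U (j p) = k p) ∧ ∀ y z, innerB B (U y) (U z) = innerB B y z := by
  have hn : ∀ p, ‖j p‖ = ‖k p‖ := fun p => by
    rw [← sq_eq_sq₀ (norm_nonneg _) (norm_nonneg _), norm_sq_eq_norm_innerB (B := B), h,
      ← norm_sq_eq_norm_innerB]
  let U : E ≃L[ℂ] F := (LinearEquiv.refl ℂ P).extend j k hj
    ⟨1, fun p => by rw [one_mul]; exact (hn p).ge⟩ hk ⟨1, fun p => by rw [one_mul]; exact (hn p).le⟩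
  have hU : ∀ p, U (j p) = k p := fun p => LinearEquiv.extend_eq _ _ _ _ _ _ _ p
  refine ⟨U, hU, fun y z => ?_⟩
  refine hj.induction_on (p := fun y => innerB B (U y) (U z) = innerB B y z) y
    (isClosed_eq (Continuous.innerB (by fun_prop) (by fun_prop))
      (Continuous.innerB (by fun_prop) (by fun_prop))) fun p => ?_
  refine hj.induction_on (p := fun z => innerB B (U (j p)) (U z) = innerB B (j p) z) z
    (isClosed_eq (Continuous.innerB (by fun_prop) (by fun_prop))
      (Continuous.innerB (by fun_prop) (by fun_prop))) fun q => ?_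
  rw [hU, hU, h]

end Unitary

section KSGNS

variable [PartialOrder C] [StarOrderedRing C] (φ : C →CP B)

/-- The sesquilinear form `⟪a ⊗ b, c ⊗ d⟫ = b* φ(a* m c) d`. -/
def weightedForm (m : C) (x y : C →₀ B) : B :=
  x.sum fun a b => y.sum fun c d => star b * φ (star a * m * c) * d

/-- Linearity in the weight `m` is what makes the left action linear in the algebra element. -/
theorem weightedForm_add (m n : C) (x y : C →₀ B) :
    weightedForm φ (m + n) x y = weightedForm φ m x y + weightedForm φ n x y := by
  simp only [weightedForm, Finsupp.sum, ← Finset.sum_add_distrib, mul_add, add_mul, map_add]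

theorem weightedForm_smul (z : ℂ) (m : C) (x y : C →₀ B) :
    weightedForm φ (z • m) x y = z • weightedForm φ m x y := by
  simp only [weightedForm, Finsupp.sum, Finset.smul_sum, mul_smul_comm, smul_mul_assoc, map_smul]

theorem weightedForm_add_right (m : C) (x y z : C →₀ B) :
    weightedForm φ m x (y + z) = weightedForm φ m x y + weightedForm φ m x z := by
  classical
  simp only [weightedForm]
  rw [← Finsupp.sum_add]
  refine Finsupp.sum_congr fun a _ => ?_
  exact Finsupp.sum_add_index' (fun c => by rw [mul_zero]) fun c b d => by rw [mul_add]

theorem weightedForm_smul_right (m : C) (z : ℂ) (x y : C →₀ B) :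
    weightedForm φ m x (z • y) = z • weightedForm φ m x y := by
  simp only [weightedForm]
  rw [Finsupp.smul_sum]
  refine Finsupp.sum_congr fun a _ => ?_
  rw [Finsupp.smul_sum, Finsupp.sum_smul_index' fun c => by rw [mul_zero]]
  simp only [mul_smul_comm]

theorem weightedForm_op_smul_right (m : C) (x y : C →₀ B) (b : B) :
    weightedForm φ m x (op b • y) = weightedForm φ m x y * b := by
  simp only [weightedForm]
  rw [Finsupp.sum_mul]
  refine Finsupp.sum_congr fun a _ => ?_
  rw [Finsupp.sum_mul, Finsupp.sum_smul_index' fun c => by rw [mul_zero]]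
  simp only [op_smul_eq_mul, mul_assoc]

theorem _root_.CompletelyPositiveMap.map_star (c : C) : φ (star c) = star (φ c) :=
  StarHomClass.map_star φ c

theorem star_weightedForm (m : C) (x y : C →₀ B) :
    star (weightedForm φ m x y) = weightedForm φ (star m) y x := by
  simp only [weightedForm, Finsupp.sum, star_sum, star_mul, star_star,
    ← CompletelyPositiveMap.map_star, mul_assoc]
  exact Finset.sum_comm

theorem weightedForm_one_self_nonneg (x : C →₀ B) : 0 ≤ weightedForm φ 1 x x := by
  have h := φ.sum_nonneg (fun i : x.support => (i : C)) fun i => x i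
  simp only [weightedForm, Finsupp.sum, mul_one]
  rw [← Finset.sum_coe_sort]
  refine h.trans_eq (Finset.sum_congr rfl fun i _ => ?_)
  exact Finset.sum_coe_sort x.support fun c => star (x i) * φ (star (i : C) * c) * x c

/-- The semi-inner product `⟪a ⊗ b, c ⊗ d⟫ = b* φ(a* c) d`. -/
def preInner : PreInner B (C →₀ B) where
  form := weightedForm φ 1
  form_add_right := weightedForm_add_right φ 1
  form_smul_right := weightedForm_smul_right φ 1
  form_op_smul_right := weightedForm_op_smul_right φ 1
  star_form x y := by rw [star_weightedForm, star_one]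
  form_self_nonneg := weightedForm_one_self_nonneg φ

theorem weightedForm_leftMul_right (m a : C) (x y : C →₀ B) :
    weightedForm φ m x (leftMul a y) = weightedForm φ (m * a) x y := by
  simp only [weightedForm]
  refine Finsupp.sum_congr fun c _ => ?_
  refine (Finsupp.sum_mapDomain_index (fun c => by rw [mul_zero])
    fun c b d => by rw [mul_add]).trans ?_
  simp only [mul_assoc]

theorem weightedForm_leftMul_left (m a : C) (x y : C →₀ B) :
    weightedForm φ m (leftMul a x) y = weightedForm φ (star a * m) x y := by
  rw [← star_star m, ← star_weightedForm, weightedForm_leftMul_right, star_weightedForm, star_mul]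

/-- Left multiplication by `a` on both sides amounts to the weight `a* a = ‖a‖² - d* d`, and the
weight `d* d` contributes a nonnegative term. -/
theorem weightedForm_leftMul_self_le (a : C) (x : C →₀ B) :
    weightedForm φ 1 (leftMul a x) (leftMul a x)
      ≤ ((‖a‖ ^ 2 : ℝ) : ℂ) • weightedForm φ 1 x x := by
  obtain ⟨d, hd⟩ := CStarAlgebra.exists_eq_star_mul_self
    (sub_nonneg.mpr (CStarAlgebra.star_mul_le_algebraMap_norm_sq (a := a)))
  have h2 : star a * (1 * a) = ((‖a‖ ^ 2 : ℝ) : ℂ) • (1 : C)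
      + (-1 : ℂ) • (star d * (1 * d)) := by
    rw [one_mul, one_mul, ← hd, Algebra.algebraMap_eq_smul_one, Complex.coe_smul, neg_one_smul,
      ← sub_eq_add_neg, sub_sub_cancel]
  have h3 : weightedForm φ 1 (leftMul a x) (leftMul a x) = ((‖a‖ ^ 2 : ℝ) : ℂ) •
      weightedForm φ 1 x x - weightedForm φ 1 (leftMul d x) (leftMul d x) := by
    rw [weightedForm_leftMul_right, weightedForm_leftMul_left, h2, weightedForm_add,
      weightedForm_smul, weightedForm_smul, neg_one_smul, ← sub_eq_add_neg,
      weightedForm_leftMul_right, weightedForm_leftMul_left]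
  exact h3.trans_le (sub_le_self _ (weightedForm_one_self_nonneg φ _))

theorem norm_leftMul_le (a : C) (x : (preInner φ).Space) :
    ‖(preInner φ).toSpace (leftMul a ((preInner φ).toSpace.symm x))‖ ≤ ‖a‖ * ‖x‖ := by
  rw [← sq_le_sq₀ (norm_nonneg _) (by positivity), mul_pow, PreInner.norm_sq, PreInner.norm_sq]
  refine (CStarAlgebra.norm_le_norm_of_nonneg_of_le (weightedForm_one_self_nonneg φ _)
    (weightedForm_leftMul_self_le φ a ((preInner φ).toSpace.symm x))).trans ?_
  rw [norm_smul, Complex.norm_real, Real.norm_of_nonneg (by positivity)]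
  rfl

/-- The Hilbert module of a completely positive map. -/
abbrev KSGNS : Type _ := (preInner φ).Compl

/-- The canonical map of the algebraic tensor product into the Hilbert module. -/
def toKSGNS : (C →₀ B) →ₗ[ℂ] KSGNS φ :=
  (Completion.toComplₗᵢ : (preInner φ).Space →ₗᵢ[ℂ] _).toLinearMap ∘ₗ
    (preInner φ).toSpace.toLinearMap

theorem denseRange_toKSGNS : DenseRange (toKSGNS φ) :=
  Completion.denseRange_coe (α := (preInner φ).Space)

theorem innerB_toKSGNS (x y : C →₀ B) :
    innerB B (toKSGNS φ x) (toKSGNS φ y) = weightedForm φ 1 x y :=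
  (preInner φ).innerB_coe x y

theorem toKSGNS_op_smul (b : B) (x : C →₀ B) : toKSGNS φ (op b • x) = op b • toKSGNS φ x :=
  Completion.coe_smul (op b) ((preInner φ).toSpace x)

theorem eq_of_innerB_toKSGNS {x y : KSGNS φ}
    (h : ∀ z, innerB B (toKSGNS φ z) x = innerB B (toKSGNS φ z) y) : x = y :=
  innerB_ext (B := B) fun z => (denseRange_toKSGNS φ).induction_on
    (p := fun z => innerB B z x = innerB B z y) z
    (isClosed_eq (Continuous.innerB continuous_id continuous_const)
      (Continuous.innerB continuous_id continuous_const)) h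

/-- The left action on the Hilbert module, as a bounded operator. -/
def leftOp (a : C) : KSGNS φ →L[ℂ] KSGNS φ :=
  (LinearMap.mkContinuous ((preInner φ).toSpace.toLinearMap ∘ₗ leftMul a ∘ₗ
    (preInner φ).toSpace.symm.toLinearMap) ‖a‖ (norm_leftMul_le φ a)).completion

theorem leftOp_toKSGNS (a : C) (x : C →₀ B) : leftOp φ a (toKSGNS φ x) = toKSGNS φ (leftMul a x) :=
  ContinuousLinearMap.completion_apply_coe _ _

theorem leftOp_ext {S T : KSGNS φ →L[ℂ] KSGNS φ}
    (h : ∀ x z, innerB B (toKSGNS φ z) (S (toKSGNS φ x)) = innerB B (toKSGNS φ z) (T (toKSGNS φ x))) :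
    S = T :=
  ContinuousLinearMap.ext fun x => (denseRange_toKSGNS φ).induction_on
    (p := fun x => S x = T x) x (isClosed_eq S.continuous T.continuous)
    fun x => eq_of_innerB_toKSGNS φ (h x)

theorem innerB_leftOp_toKSGNS (a : C) (x y : C →₀ B) :
    innerB B (toKSGNS φ x) (leftOp φ a (toKSGNS φ y)) = weightedForm φ a x y := by
  rw [leftOp_toKSGNS, innerB_toKSGNS, weightedForm_leftMul_right, one_mul]

theorem innerB_leftOp (a : C) (x y : KSGNS φ) :
    innerB B (leftOp φ a x) y = innerB B x (leftOp φ (star a) y) := by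
  refine (denseRange_toKSGNS φ).induction_on
    (p := fun x => innerB B (leftOp φ a x) y = innerB B x (leftOp φ (star a) y)) x
    (isClosed_eq (Continuous.innerB (by fun_prop) (by fun_prop))
      (Continuous.innerB (by fun_prop) (by fun_prop))) fun x => ?_
  refine (denseRange_toKSGNS φ).induction_on
    (p := fun y => innerB B (leftOp φ a (toKSGNS φ x)) y
      = innerB B (toKSGNS φ x) (leftOp φ (star a) y)) y
    (isClosed_eq (Continuous.innerB (by fun_prop) (by fun_prop))
      (Continuous.innerB (by fun_prop) (by fun_prop))) fun y => ?_
  rw [innerB_leftOp_toKSGNS, leftOp_toKSGNS, innerB_toKSGNS, weightedForm_leftMul_left, mul_one]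

/-- The left action on the Hilbert module, as an adjointable operator. -/
def leftAction (a : C) : adjointable B (KSGNS φ) :=
  ⟨leftOp φ a, leftOp φ (star a), innerB_leftOp φ a⟩

theorem star_leftAction (a : C) : star (leftAction φ a) = leftAction φ (star a) :=
  adjoint_unique (T := leftAction φ a) (S := leftAction φ (star a)) (innerB_leftOp φ a)

/-- The representation on the Hilbert module of a completely positive map. -/
def ksgnsRep : C →⋆ₐ[ℂ] adjointable B (KSGNS φ) where
  toFun := leftAction φ
  map_one' := Subtype.ext <| leftOp_ext φ fun x z => by
    change innerB B _ (leftOp φ 1 (toKSGNS φ x)) = innerB B _ (toKSGNS φ x)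
    rw [leftOp_toKSGNS, leftMul_one]
  map_mul' a c := Subtype.ext <| leftOp_ext φ fun x z => by
    change innerB B _ (leftOp φ (a * c) (toKSGNS φ x))
      = innerB B _ (leftOp φ a (leftOp φ c (toKSGNS φ x)))
    rw [leftOp_toKSGNS, leftMul_mul, leftOp_toKSGNS, leftOp_toKSGNS]
  -- On `C →₀ B` the map `leftMul a` is not linear in `a`, since no relations are imposed between
  -- the basis elements indexed by `C`. Linearity holds only modulo null vectors, so this and the
  -- next fields are tested against the form.
  map_zero' := Subtype.ext <| leftOp_ext φ fun x z => by
    change innerB B _ (leftOp φ 0 (toKSGNS φ x)) = innerB B _ (0 : KSGNS φ)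
    rw [innerB_leftOp_toKSGNS, ← zero_smul ℂ (0 : C), weightedForm_smul, zero_smul,
      ← zero_smul ℂ (0 : KSGNS φ), innerB_complex_smul_right, zero_smul]
  map_add' a c := Subtype.ext <| leftOp_ext φ fun x z => by
    change innerB B _ (leftOp φ (a + c) (toKSGNS φ x))
      = innerB B _ (leftOp φ a (toKSGNS φ x) + leftOp φ c (toKSGNS φ x))
    rw [innerB_add_right, innerB_leftOp_toKSGNS, innerB_leftOp_toKSGNS, innerB_leftOp_toKSGNS,
      weightedForm_add]
  commutes' w := Subtype.ext <| leftOp_ext φ fun x z => by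
    change innerB B _ (leftOp φ (algebraMap ℂ C w) (toKSGNS φ x))
      = innerB B _ (w • toKSGNS φ x)
    rw [innerB_leftOp_toKSGNS, Algebra.algebraMap_eq_smul_one, weightedForm_smul,
      innerB_complex_smul_right, innerB_toKSGNS]
  map_star' a := (star_leftAction φ a).symm

/-- The cyclic vector of the Hilbert module of a completely positive map. -/
def ksgnsVector : KSGNS φ := toKSGNS φ (Finsupp.single 1 1)

theorem ksgnsRep_vector (c : C) (b : B) :
    (ksgnsRep φ c).1 (op b • ksgnsVector φ) = toKSGNS φ (Finsupp.single c b) := by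
  change leftOp φ c _ = _
  rw [ksgnsVector, ← toKSGNS_op_smul, leftOp_toKSGNS, Finsupp.smul_single, op_smul_eq_mul, one_mul,
    leftMul_single, mul_one]

theorem innerB_ksgnsRep_vector (c : C) :
    innerB B (ksgnsVector φ) ((ksgnsRep φ c).1 (ksgnsVector φ)) = φ c := by
  change innerB B _ (leftOp φ c (toKSGNS φ _)) = _
  rw [ksgnsVector, innerB_leftOp_toKSGNS, weightedForm, Finsupp.sum_single_index,
    Finsupp.sum_single_index] <;> simp

/-- Cyclicity of `1 ⊗ 1`: its orbit map is the canonical map, which has dense range. -/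
theorem orbitMap_ksgns : orbitMap (ksgnsRep φ) (ksgnsVector φ) = toKSGNS φ := by
  refine Finsupp.lhom_ext fun c b => ?_
  rw [orbitMap_single, ksgnsRep_vector]

theorem denseRange_orbitMap_ksgns : DenseRange (orbitMap (ksgnsRep φ) (ksgnsVector φ)) := by
  rw [orbitMap_ksgns]
  exact denseRange_toKSGNS φ

end KSGNS

end

end HilbertModule

/-! ### Equivariance of orbit maps and of unitaries -/

namespace HilbertModule

open MulOpposite

noncomputable section

variable {B : Type*} [CStarAlgebra B] [PartialOrder B] [StarOrderedRing B]
  {C : Type*} [CStarAlgebra C]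
  {E F : Type*} [NormedAddCommGroup E] [NormedSpace ℂ E] [Module Bᵐᵒᵖ E] [CStarModule Bᵐᵒᵖ E]
  [NormedAddCommGroup F] [NormedSpace ℂ F] [Module Bᵐᵒᵖ F] [CStarModule Bᵐᵒᵖ F]

theorem orbitMap_leftMul (σ : C →⋆ₐ[ℂ] adjointable B E) (x : E) (c : C) (f : C →₀ B) :
    orbitMap σ x (leftMul c f) = (σ c).1 (orbitMap σ x f) := by
  have h : orbitMap σ x ∘ₗ leftMul c = (σ c).1.toLinearMap ∘ₗ orbitMap σ x :=
    Finsupp.lhom_ext fun a b => by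
      change orbitMap σ x (leftMul c (Finsupp.single a b))
        = (σ c).1 (orbitMap σ x (Finsupp.single a b))
      rw [leftMul_single, orbitMap_single, orbitMap_single, map_mul]
      rfl
  exact LinearMap.congr_fun h f

theorem orbitMap_single_one (σ : C →⋆ₐ[ℂ] adjointable B E) (x : E) :
    orbitMap σ x (Finsupp.single 1 1) = x := by
  rw [orbitMap_single, map_one, adjointable_one_apply, op_one, one_smul]

/-- Every vector of `F` has the form `U w`, and `⟪U w, U (y b)⟫ = ⟪w, y⟫ b = ⟪U w, (U y) b⟫`. -/
theorem map_op_smul_of_innerB (U : E ≃ₗ[ℂ] F) (h : ∀ y z, innerB B (U y) (U z) = innerB B y z)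
    (b : B) (y : E) : U (op b • y) = op b • U y :=
  innerB_ext (B := B) fun z => by
    obtain ⟨w, rfl⟩ := U.surjective z
    rw [h, innerB_smul_right, innerB_smul_right, h]

theorem continuous_of_innerB (U : E ≃ₗ[ℂ] F) (h : ∀ y z, innerB B (U y) (U z) = innerB B y z) :
    Continuous U :=
  AddMonoidHomClass.continuous_of_bound U 1 fun y => by
    rw [one_mul, ← sq_le_sq₀ (norm_nonneg _) (norm_nonneg _), norm_sq_eq_norm_innerB (B := B), h,
      ← norm_sq_eq_norm_innerB]

end

end HilbertModule

/-! ### Minimal tuples as cyclic representations of `A * A`, and the bijection -/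

namespace JointRepresentation

open HilbertModule CStarFree MulOpposite
open scoped CStarAlgebra

variable {A : Type u} {B : Type v} [CStarAlgebra A] [PartialOrder A] [StarOrderedRing A]
  [CStarAlgebra B] [PartialOrder B] [StarOrderedRing B] {φ₁ φ₂ : A →CP B}

namespace Tuple

/-- The representation of the full free product given by a tuple. -/
noncomputable def rep (T : Tuple φ₁ φ₂) : Full A →⋆ₐ[ℂ] adjointable B T.E :=
  extendRep (algRep ![T.σ₁, T.σ₂])

theorem extends_rep (T : Tuple φ₁ φ₂) : T.Extends T.rep :=
  ⟨fun _ => (extendRep_of _ _).trans (algRep_ι _ _ _),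
    fun _ => (extendRep_of _ _).trans (algRep_ι _ _ _)⟩

theorem Extends.eq_rep {T : Tuple φ₁ φ₂} {σ : Full A →⋆ₐ[ℂ] adjointable B T.E}
    (h : T.Extends σ) : σ = T.rep :=
  fullRep_ext fun i a => by
    fin_cases i
    · exact (h.1 a).trans (T.extends_rep.1 a).symm
    · exact (h.2 a).trans (T.extends_rep.2 a).symm

end Tuple

/-- The element of `A ∘ A` given by a word. -/
noncomputable def algWord (l : List (A ⊕ A)) : Alg A :=
  (l.map (Sum.elim (Alg.ι 0) (Alg.ι 1))).prod

/-- Concatenation keeps words nonempty, and scalars need no empty word because they lie in the image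
of `ι 0`. -/
theorem mem_span_algWord (c : Alg A) :
    c ∈ Submodule.span ℂ {w : Alg A | ∃ l : List (A ⊕ A), l ≠ [] ∧ w = algWord l} := by
  induction c using Alg.induction with
  | hι i a =>
    refine Submodule.subset_span ?_
    fin_cases i
    · exact ⟨[Sum.inl a], by simp, by simp [algWord]⟩
    · exact ⟨[Sum.inr a], by simp, by simp [algWord]⟩
  | hadd c d hc hd => exact add_mem hc hd
  | hmul c d hc hd =>
    have h := Submodule.mul_mem_mul hc hd
    rw [Submodule.span_mul_span] at h
    refine Submodule.span_mono ?_ h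
    rintro _ ⟨_, ⟨l, hl, rfl⟩, _, ⟨m, hm, rfl⟩, rfl⟩
    exact ⟨l ++ m, by simp [hl], by simp [algWord]⟩

namespace Tuple

theorem word_eq (T : Tuple φ₁ φ₂) (l : List (A ⊕ A)) :
    T.word l = T.rep (Full.of (algWord l)) := by
  rw [word, algWord, map_list_prod, map_list_prod, List.map_map, List.map_map]
  refine congrArg List.prod (List.map_congr_left ?_)
  rintro (a | a) _
  · exact (T.extends_rep.1 a).symm
  · exact (T.extends_rep.2 a).symm

/-- Words in `σ₁, σ₂` are the images of words in `A ∘ A`. These span `A ∘ A`, which is dense in `A *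
A`, and strong continuity keeps the remaining orbit vectors in the closed span. -/
theorem isMinimal_iff (T : Tuple φ₁ φ₂) :
    T.IsMinimal ↔ DenseRange (orbitMap T.rep T.x) := by
  rw [denseRange_orbitMap_iff, IsMinimal]
  refine ⟨fun h => ?_, fun h => ?_⟩
  · rw [eq_top_iff, ← h]
    refine Submodule.topologicalClosure_mono (Submodule.span_mono ?_)
    rintro _ ⟨l, -, b, rfl⟩
    exact ⟨Full.of (algWord l), b, by rw [word_eq]⟩
  · rw [eq_top_iff, ← h]
    refine Submodule.topologicalClosure_minimal _ (Submodule.span_le.mpr ?_)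
      (Submodule.isClosed_topologicalClosure _)
    rintro _ ⟨c, b, rfl⟩
    refine Full.induction (p := fun c => (T.rep c).1 (op b • T.x) ∈
      (Submodule.span ℂ {y : T.E | ∃ l : List (A ⊕ A), l ≠ [] ∧ ∃ b : B,
        y = (T.word l).1 (op b • T.x)}).topologicalClosure)
      ((Submodule.isClosed_topologicalClosure _).preimage (continuous_rep_apply T.rep _))
      (fun c => ?_) c
    refine Submodule.le_topologicalClosure _ ?_
    induction mem_span_algWord c using Submodule.span_induction with
    | mem w hw =>
      obtain ⟨l, hl, rfl⟩ := hw
      exact Submodule.subset_span ⟨l, hl, b, by rw [word_eq]⟩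
    | zero =>
      rw [map_zero, map_zero]
      exact zero_mem _
    | add c d _ _ hc hd =>
      rw [map_add, map_add]
      exact add_mem hc hd
    | smul z c _ hc =>
      rw [map_smul Full.of, map_smul T.rep]
      exact Submodule.smul_mem _ z hc

theorem Iso.map_rep {T S : Tuple φ₁ φ₂} {U : T.E ≃ₗ[ℂ] S.E}
    (hU : ∀ y z, innerB B (U y) (U z) = innerB B y z)
    (h₁ : ∀ a y, U ((T.σ₁ a).1 y) = (S.σ₁ a).1 (U y))
    (h₂ : ∀ a y, U ((T.σ₂ a).1 y) = (S.σ₂ a).1 (U y)) (c : Full A) (y : T.E) :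
    U ((T.rep c).1 y) = (S.rep c).1 (U y) := by
  have hc := continuous_of_innerB U hU
  refine Full.induction (p := fun c => U ((T.rep c).1 y) = (S.rep c).1 (U y))
    (isClosed_eq (hc.comp (continuous_rep_apply T.rep y)) (continuous_rep_apply S.rep _))
    (fun c => ?_) c
  -- In the product case the hypothesis for the left factor is applied to the image of `y` under the
  -- right factor.
  induction c using Alg.induction generalizing y with
  | hι i a =>
    fin_cases i
    · have h := h₁ a y
      rw [← T.extends_rep.1, ← S.extends_rep.1] at h
      exact h
    · have h := h₂ a y
      rw [← T.extends_rep.2, ← S.extends_rep.2] at h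
      exact h
  | hadd c d hc hd =>
    rw [map_add, map_add, map_add, adjointable_add_apply, adjointable_add_apply, map_add, hc, hd]
  | hmul c d hc hd =>
    rw [map_mul, map_mul, map_mul, adjointable_mul_apply, adjointable_mul_apply, hc, hd]

/-- The completely positive map of a tuple. -/
noncomputable def toK (T : Tuple φ₁ φ₂) : K φ₁ φ₂ :=
  ⟨vectorMap T.rep T.x,
    fun a => by rw [vectorMap_apply, T.extends_rep.1, T.repr₁],
    fun a => by rw [vectorMap_apply, T.extends_rep.2, T.repr₂]⟩

theorem toK_apply (T : Tuple φ₁ φ₂) (c : Full A) :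
    T.toK.1 c = innerB B T.x ((T.rep c).1 T.x) := rfl

theorem Iso.toK_eq {T S : Tuple φ₁ φ₂} (h : T.Iso S) : T.toK = S.toK := by
  obtain ⟨U, hU, -, h₁, h₂, hx⟩ := h
  refine Subtype.ext (DFunLike.ext _ _ fun c => ?_)
  rw [toK_apply, toK_apply, ← hU, Iso.map_rep hU h₁ h₂, hx]

/-- Equal maps give the two orbit maps the same inner products on `Full A →₀ B`; minimality makes
both ranges dense. -/
theorem iso_of_toK_eq {T S : Tuple φ₁ φ₂} (hT : T.IsMinimal) (hS : S.IsMinimal)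
    (h : T.toK = S.toK) : T.Iso S := by
  have hc : ∀ c, innerB B T.x ((T.rep c).1 T.x) = innerB B S.x ((S.rep c).1 S.x) := fun c =>
    DFunLike.congr_fun (congrArg Subtype.val h) c
  obtain ⟨U, hUj, hU⟩ := exists_unitary (B := B) (orbitMap T.rep T.x) (orbitMap S.rep S.x)
    (T.isMinimal_iff.mp hT) (S.isMinimal_iff.mp hS) fun p q => by
      simp only [innerB_orbitMap, hc]
  -- On orbit vectors both actions come from the same `leftMul c`; density does the rest.
  have hrep : ∀ c y, U ((T.rep c).1 y) = (S.rep c).1 (U y) := fun c y =>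
    (T.isMinimal_iff.mp hT).induction_on
      (p := fun y => U ((T.rep c).1 y) = (S.rep c).1 (U y)) y
      (isClosed_eq (by fun_prop) (by fun_prop)) fun p => by
        rw [← orbitMap_leftMul, hUj, hUj, orbitMap_leftMul]
  refine ⟨U.toLinearEquiv, hU, map_op_smul_of_innerB U.toLinearEquiv hU, fun a y => ?_,
    fun a y => ?_, ?_⟩
  · rw [← T.extends_rep.1, ← S.extends_rep.1]
    exact hrep _ y
  · rw [← T.extends_rep.2, ← S.extends_rep.2]
    exact hrep _ y
  · have h1 := hUj (Finsupp.single 1 1)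
    rwa [orbitMap_single_one, orbitMap_single_one] at h1

end Tuple

/-- The tuple of a completely positive map on the full free product. -/
noncomputable def K.toTuple (h₁ : φ₁ 1 = 1) (φ : K φ₁ φ₂) : Tuple φ₁ φ₂ where
  E := KSGNS φ.1
  σ₁ := (ksgnsRep φ.1).comp (Full.ρ 0)
  σ₂ := (ksgnsRep φ.1).comp (Full.ρ 1)
  x := ksgnsVector φ.1
  -- `⟪x, x⟫ = φ 1 = φ (ρ₁ 1) = φ₁ 1`, so unitality of `φ₁` makes the cyclic vector a unit vector.
  inner_x := by
    have h := innerB_ksgnsRep_vector φ.1 1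
    rw [map_one, adjointable_one_apply] at h
    rw [h, ← map_one (Full.ρ 0), φ.2.1, h₁]
  repr₁ a := ((innerB_ksgnsRep_vector φ.1 _).trans (φ.2.1 a)).symm
  repr₂ a := ((innerB_ksgnsRep_vector φ.1 _).trans (φ.2.2 a)).symm

theorem K.rep_toTuple (h₁ : φ₁ 1 = 1) (φ : K φ₁ φ₂) : (φ.toTuple h₁).rep = ksgnsRep φ.1 :=
  (Tuple.Extends.eq_rep (T := φ.toTuple h₁) ⟨fun _ => rfl, fun _ => rfl⟩).symm

theorem K.isMinimal_toTuple (h₁ : φ₁ 1 = 1) (φ : K φ₁ φ₂) : (φ.toTuple h₁).IsMinimal := by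
  rw [Tuple.isMinimal_iff, K.rep_toTuple]
  exact denseRange_orbitMap_ksgns φ.1

theorem K.toK_toTuple (h₁ : φ₁ 1 = 1) (φ : K φ₁ φ₂) : (φ.toTuple h₁).toK = φ :=
  Subtype.ext (DFunLike.ext _ _ fun c => by
    rw [Tuple.toK_apply, K.rep_toTuple]
    exact innerB_ksgnsRep_vector φ.1 c)

end JointRepresentation

theorem mainTheorem5 {A : Type u} {B : Type v}
    [CStarAlgebra A] [PartialOrder A] [StarOrderedRing A]
    [CStarAlgebra B] [PartialOrder B] [StarOrderedRing B]
    (φ₁ φ₂ : CompletelyPositiveMap A B) (h₁ : φ₁ 1 = 1) (h₂ : φ₂ 1 = 1) :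
    ∃ Φ : Quotient (JointRepresentation.minimalSetoid φ₁ φ₂) → JointRepresentation.K φ₁ φ₂,
      Function.Bijective Φ ∧
      ∀ T : JointRepresentation.MinimalTuple φ₁ φ₂,
        (∃! σ : CStarFree.Full A →⋆ₐ[ℂ] HilbertModule.adjointable B T.1.E, T.1.Extends σ) ∧
        ∀ σ : CStarFree.Full A →⋆ₐ[ℂ] HilbertModule.adjointable B T.1.E, T.1.Extends σ →
          ∀ c : CStarFree.Full A,
            (Φ ⟦T⟧).1 c = HilbertModule.innerB B T.1.x ((σ c).1 T.1.x) := by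
  refine ⟨Quotient.lift (fun T => T.1.toK) fun T S h =>
    JointRepresentation.Tuple.Iso.toK_eq h, ⟨?_, fun φ => ?_⟩, fun T => ⟨?_, ?_⟩⟩
  · rintro ⟨T⟩ ⟨S⟩ h
    exact Quotient.sound (JointRepresentation.Tuple.iso_of_toK_eq T.2 S.2 h)
  · exact ⟨⟦⟨φ.toTuple h₁, φ.isMinimal_toTuple h₁⟩⟧, φ.toK_toTuple h₁⟩
  · exact ⟨T.1.rep, T.1.extends_rep, fun σ hσ => hσ.eq_rep⟩
  · intro σ hσ c
    rw [hσ.eq_rep]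
    rfl
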